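/- Let $q\in\mathbb{C}^\times$ not be a root of unity and put $\lambda=q-q^{-1}$. Let $\mathcal{H}_n=\mathcal{H}_n(q)$ be the Hecke algebra: the unital associative $\mathbb{C}$-algebra with generators $\sigma_1,\dots,\sigma_{n-1}$ and relations $\sigma_i\sigma_{i+1}\sigma_i=\sigma_{i+1}\sigma_i\sigma_{i+1}$, $\sigma_i\sigma_k=\sigma_k\sigma_i$ for $|i-k|>1$, and $(\sigma_i-q)(\sigma_i+q^{-1})=0$. Let $X_i(x)=\sigma_i+\frac{\lambda x}{1-x}$ for $x\in\mathbb{C}\setminus\{1\}$, and for $v\in\mathbb{C}^m$ write $$\vec X_{m,j}(v)=X_j(v_1)X_{j+1}(v_2)\cdots X_{j+m-1}(v_m),\qquad \overleftarrow X_{m,j}(v)=X_{j+m-1}(v_1)X_{j+m-2}(v_2)\cdots X_j(v_m).$$ Define $J_{1,j}=1$ and $J_{i+1,j}=\sigma_{j+i-1}J_{i,j}\sigma_{j+i-1}$ (shifted Jucys–Murphy elements). Let $\mathcal{T}_m$ be a standard Young tableau with $m$ nodes. Give a node in row $a$ and column $b$ the quantum content $q^{2(b-a)}$; let $c_i$ be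 the quantum content of the node filled with $i$, and let $\mathcal{T}_i$ be the subtableau formed by the nodes filled with $1,\dots,i$. Define the idempotents $A_j^{\mathcal{T}_m}$ inductively by $A_j^{\mathcal{T}_0}=1$ and $$A_j^{\mathcal{T}_m}=A_j^{\mathcal{T}_{m-1}}\prod_{\beta}\frac{J_{m,j}-c_\beta}{c_m-c_\beta},$$ where $\beta$ runs through the addable nodes of the shape of $\mathcal{T}_{m-1}$ (those whose addition gives a Young diagram) other than the node of $\mathcal{T}_m$ filled with $m$, and $c_\beta$ is the quantum content of $\beta$. Finally define the projected fused operators $$X^{\mathcal{T}_m}_{j,+}(x)=A_{j+1}^{\mathcal{T}_m}\,\vec X_{m,j}(xc_1,\dots,xc_m),\qquad X^{\mathcal{T}_m}_{j,-}(x)=A_{j}^{\mathcal{T}_m}\,\overleftarrow X_{m,j}(x/c_m,\dots,x/c_1).$$ **Proposition.** Let $j\ge1$, $m\ge 0$ and $j+m<n$, and let $\mathcal{T}_m$ be a standard Young tableau with $m$ nodes. Then the following projected fused Yang–Baxter equations hold in $\mathcal{H}_n$ for all $x,z\in\mathbb{C}$ for which the arguments of all Baxterized elements that occur are defined and different from $1$: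 1. if $z\neq0$, $x\ne z$, and $xc_i\neq1$, $zc_i\ne1$ for all $i$, then $$X_j(x/z)\,X^{\mathcal{T}_m}_{j+1,+}(x)\,X^{\mathcal{T}_m}_{j,+}(z)=X^{\mathcal{T}_m}_{j+1,+}(z)\,X^{\mathcal{T}_m}_{j,+}(x)\,X_{j+m}(x/z);$$ 2. if $z\neq0$, $x\ne z$, and $x\neq c_i$, $z\ne c_i$ for all $i$, then $$X_{j+m}(x/z)\,X^{\mathcal{T}_m}_{j,-}(x)\,X^{\mathcal{T}_m}_{j+1,-}(z)=X^{\mathcal{T}_m}_{j,-}(z)\,X^{\mathcal{T}_m}_{j+1,-}(x)\,X_{j}(x/z);$$ 3. if $xz\ne1$, and $xc_i\neq1$, $z\ne c_i$ for all $i$, then $$X^{\mathcal{T}_m}_{j,+}(x)\,X_{j+m}(xz)\,X^{\mathcal{T}_m}_{j,-}(z)=X^{\mathcal{T}_m}_{j+1,-}(z)\,X_{j}(xz)\,X^{\mathcal{T}_m}_{j+1,+}(x).$$ -/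

import Mathlib

namespace BaxterizedHecke

/-! ### The Hecke algebra of type `A_{n-1}` -/

/-- The defining relations of the Hecke algebra `H_n(q)`; the generator with index `k : Fin (n - 1)`
is the elementary element `σ_{k+1}`. -/
inductive HeckeRel (n : ℕ) (q : ℂ) :
    FreeAlgebra ℂ (Fin (n - 1)) → FreeAlgebra ℂ (Fin (n - 1)) → Prop
  | braid (i k : Fin (n - 1)) (h : (i : ℕ) + 1 = k) :
      HeckeRel n q
        (FreeAlgebra.ι ℂ i * FreeAlgebra.ι ℂ k * FreeAlgebra.ι ℂ i)
        (FreeAlgebra.ι ℂ k * FreeAlgebra.ι ℂ i * FreeAlgebra.ι ℂ k)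
  | comm (i k : Fin (n - 1)) (h : (i : ℕ) + 1 < k) :
      HeckeRel n q
        (FreeAlgebra.ι ℂ i * FreeAlgebra.ι ℂ k)
        (FreeAlgebra.ι ℂ k * FreeAlgebra.ι ℂ i)
  | quad (i : Fin (n - 1)) :
      HeckeRel n q
        ((FreeAlgebra.ι ℂ i - algebraMap ℂ _ q) * (FreeAlgebra.ι ℂ i + algebraMap ℂ _ q⁻¹))
        0

/-- The Hecke algebra `H_n(q)`: the associative unital `ℂ`-algebra given by generators and
relations. (For `q ≠ 0` the generators are invertible by the quadratic relation, see
`sigma_mul_inverse` and `inverse_mul_sigma`.) -/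
abbrev HeckeAlgebra (n : ℕ) (q : ℂ) : Type := RingQuot (HeckeRel n q)

/-- The elementary element `σ_i` of `H_n(q)` for `1 ≤ i ≤ n - 1`. (Outside this range `σ_i` does
not exist, and the value `1` is a placeholder.) -/
noncomputable def sigma (n : ℕ) (q : ℂ) (i : ℕ) : HeckeAlgebra n q :=
  if h : 1 ≤ i ∧ i < n then
    RingQuot.mkAlgHom ℂ (HeckeRel n q) (FreeAlgebra.ι ℂ (⟨i - 1, by omega⟩ : Fin (n - 1)))
  else 1

theorem sigma_quad (n : ℕ) (q : ℂ) {i : ℕ} (h1 : 1 ≤ i) (hn : i < n) :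
    (sigma n q i - algebraMap ℂ _ q) * (sigma n q i + algebraMap ℂ _ q⁻¹) = 0 := by
  have h := RingQuot.mkAlgHom_rel ℂ (HeckeRel.quad (n := n) (q := q) ⟨i - 1, by omega⟩)
  simpa [sigma, h1, hn] using h

theorem sigma_mul_inverse (n : ℕ) (q : ℂ) (hq : q ≠ 0) {i : ℕ} (h1 : 1 ≤ i) (hn : i < n) :
    sigma n q i * (sigma n q i - algebraMap ℂ _ (q - q⁻¹)) = 1 := by
  have h := sigma_quad n q h1 hn
  have hc := (Algebra.commutes q (sigma n q i)).symm
  have hqq : algebraMap ℂ (HeckeAlgebra n q) q * algebraMap ℂ _ q⁻¹ = 1 := by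
    rw [← map_mul, mul_inv_cancel₀ hq, map_one]
  rw [sub_mul, mul_add, mul_add, hqq, ← hc] at h
  rw [map_sub, mul_sub, mul_sub, ← sub_eq_zero, ← h]
  abel

theorem inverse_mul_sigma (n : ℕ) (q : ℂ) (hq : q ≠ 0) {i : ℕ} (h1 : 1 ≤ i) (hn : i < n) :
    (sigma n q i - algebraMap ℂ _ (q - q⁻¹)) * sigma n q i = 1 := by
  rw [← sigma_mul_inverse n q hq h1 hn, sub_mul, mul_sub, Algebra.commutes]

/-- The Baxterized element `X_i(x) = σ_i + λ x / (1 - x)`, `λ = q - q⁻¹`, for `x ≠ 1`. -/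
noncomputable def baxter (n : ℕ) (q : ℂ) (i : ℕ) (x : ℂ) : HeckeAlgebra n q :=
  sigma n q i + algebraMap ℂ _ ((q - q⁻¹) * x / (1 - x))

/-- The ordered product `X_j(v_1) X_{j+1}(v_2) ⋯ X_{j+m-1}(v_m)`. -/
noncomputable def baxterRight (n : ℕ) (q : ℂ) {m : ℕ} (j : ℕ) (v : Fin m → ℂ) :
    HeckeAlgebra n q :=
  (List.ofFn fun k : Fin m => baxter n q (j + (k : ℕ)) (v k)).prod

/-- The ordered product `X_{j+m-1}(v_1) X_{j+m-2}(v_2) ⋯ X_j(v_m)`. -/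
noncomputable def baxterLeft (n : ℕ) (q : ℂ) {m : ℕ} (j : ℕ) (v : Fin m → ℂ) :
    HeckeAlgebra n q :=
  (List.ofFn fun k : Fin m => baxter n q (j + (k.rev : ℕ)) (v k)).prod

/-- The `j`-shifted Jucys-Murphy elements: `jucysMurphy n q j k` is `J_{k+1,j}`, so that
`J_{1,j} = 1` and `J_{i+1,j} = σ_{j+i-1} J_{i,j} σ_{j+i-1}`. -/
noncomputable def jucysMurphy (n : ℕ) (q : ℂ) (j : ℕ) : ℕ → HeckeAlgebra n q
  | 0 => 1
  | k + 1 => sigma n q (j + k) * jucysMurphy n q j k * sigma n q (j + k)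

/-! ### Standard Young tableaux -/

/-- A node outside a Young diagram is addable if adding it gives a Young diagram. -/
def IsAddable (μ : YoungDiagram) (β : ℕ × ℕ) : Prop :=
  β ∉ μ.cells ∧ IsLowerSet (↑(insert β μ.cells) : Set (ℕ × ℕ))

open Classical in
/-- The finite set of addable nodes of a Young diagram (see `mem_addableNodes`). -/
noncomputable def addableNodes (μ : YoungDiagram) : Finset (ℕ × ℕ) :=
  (Finset.range (μ.card + 1) ×ˢ Finset.range (μ.card + 1)).filter (IsAddable μ)

theorem mem_addableNodes (μ : YoungDiagram) (β : ℕ × ℕ) :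
    β ∈ addableNodes μ ↔ IsAddable μ β := by
  classical
  simp only [addableNodes, Finset.mem_filter, Finset.mem_product, Finset.mem_range,
    and_iff_right_iff_imp]
  rintro ⟨-, hl⟩
  have key : ∀ α : ℕ × ℕ, α ≤ β → α ≠ β → α ∈ μ.cells := by
    intro α h1 h2
    have h3 : α ∈ (↑(insert β μ.cells) : Set (ℕ × ℕ)) := hl h1 (by simp)
    have h4 : α ∈ insert β μ.cells := by exact_mod_cast h3
    exact (Finset.mem_insert.1 h4).resolve_left h2
  constructor
  · have h : (Finset.range β.1).card ≤ μ.cells.card := by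
      refine Finset.card_le_card_of_injOn (fun i => (i, β.2)) ?_ ?_
      · intro i hi
        have hi' : i < β.1 := by simpa using hi
        refine key _ (Prod.mk_le_mk.2 ⟨hi'.le, le_rfl⟩) ?_
        intro h
        have h5 := congrArg Prod.fst h
        simp only at h5
        omega
      · intro a _ b _ h
        exact congrArg Prod.fst h
    rw [Finset.card_range] at h
    exact Nat.lt_succ_of_le h
  · have h : (Finset.range β.2).card ≤ μ.cells.card := by
      refine Finset.card_le_card_of_injOn (fun i => (β.1, i)) ?_ ?_
      · intro i hi
        have hi' : i < β.2 := by simpa using hi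
        refine key _ (Prod.mk_le_mk.2 ⟨le_rfl, hi'.le⟩) ?_
        intro h
        have h5 := congrArg Prod.snd h
        simp only at h5
        omega
      · intro a _ b _ h
        exact congrArg Prod.snd h
    rw [Finset.card_range] at h
    exact Nat.lt_succ_of_le h

/-- A standard Young `m`-tableau: a Young diagram whose nodes `(row, column)` (both counted from
`0`) are filled bijectively with the numbers `1, …, m`, increasingly along rows and columns.
The node filled with `k + 1` is `node k`, for `k : Fin m`. -/
structure StandardTableau (m : ℕ) where
  /-- the shape of the tableau -/
  shape : YoungDiagram
  /-- the position of each number -/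
  node : Fin m → ℕ × ℕ
  node_injective : Function.Injective node
  mem_shape_iff : ∀ α : ℕ × ℕ, α ∈ shape.cells ↔ ∃ k, node k = α
  row_lt : ∀ k l : Fin m, (node k).1 = (node l).1 → (node k).2 < (node l).2 → k < l
  col_lt : ∀ k l : Fin m, (node k).2 = (node l).2 → (node k).1 < (node l).1 → k < l

/-- In a standard tableau the numbers increase for the product order of the nodes. -/
theorem StandardTableau.le_of_node_le {m : ℕ} (T : StandardTableau m) (k l : Fin m)
    (h : T.node k ≤ T.node l) : k ≤ l := by
  obtain ⟨h1, h2⟩ := Prod.le_def.1 h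
  have hmem : ((T.node k).1, (T.node l).2) ∈ T.shape.cells :=
    T.shape.isLowerSet (Prod.le_def.2 ⟨h1, le_rfl⟩) ((T.mem_shape_iff _).2 ⟨l, rfl⟩)
  obtain ⟨p, hp⟩ := (T.mem_shape_iff _).1 hmem
  have hkp : k ≤ p := by
    rcases h2.lt_or_eq with h2 | h2
    · exact (T.row_lt k p (by rw [hp]) (by rw [hp]; exact h2)).le
    · exact (T.node_injective (by rw [hp, ← h2])).le
  have hpl : p ≤ l := by
    rcases h1.lt_or_eq with h1 | h1
    · exact (T.col_lt p l (by rw [hp]) (by rw [hp]; exact h1)).le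
    · exact (T.node_injective (by rw [hp, h1])).le
  exact hkp.trans hpl

/-- The subtableau `T_m` of `T_{m+1}`, obtained by removing the last node. -/
def StandardTableau.init {m : ℕ} (T : StandardTableau (m + 1)) : StandardTableau m where
  shape :=
    { cells := T.shape.cells.erase (T.node (Fin.last m))
      isLowerSet := by
        intro a b hba ha
        rw [Finset.mem_coe, Finset.mem_erase] at ha ⊢
        refine ⟨?_, T.shape.isLowerSet hba ha.2⟩
        rintro rfl
        obtain ⟨l, rfl⟩ := (T.mem_shape_iff a).1 ha.2
        have hl := T.le_of_node_le _ _ hba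
        exact ha.1 (congrArg T.node (le_antisymm (Fin.le_last l) hl)) }
  node k := T.node k.castSucc
  node_injective := fun k l h => Fin.castSucc_injective m (T.node_injective h)
  mem_shape_iff α := by
    rw [Finset.mem_erase, T.mem_shape_iff]
    constructor
    · rintro ⟨hne, k, rfl⟩
      have hk : k ≠ Fin.last m := fun h => hne (congrArg T.node h)
      exact ⟨k.castPred hk, by simp⟩
    · rintro ⟨k, rfl⟩
      exact ⟨fun h => (Fin.castSucc_lt_last k).ne (T.node_injective h), _, rfl⟩
  row_lt k l h1 h2 := T.row_lt k.castSucc l.castSucc h1 h2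
  col_lt k l h1 h2 := T.col_lt k.castSucc l.castSucc h1 h2

/-- The quantum content `q ^ (2 (column - row))` of a node. -/
noncomputable def nodeContent (q : ℂ) (α : ℕ × ℕ) : ℂ :=
  q ^ (2 * ((α.2 : ℤ) - (α.1 : ℤ)))

/-- The quantum contents `c_1, …, c_m` of a standard tableau (`content q T k` is `c_{k+1}`). -/
noncomputable def content (q : ℂ) {m : ℕ} (T : StandardTableau m) (k : Fin m) : ℂ :=
  nodeContent q (T.node k)

/-! ### Idempotents and projected fused operators -/

/-- The idempotent `A_j^{T_m}`, defined inductively by `A_j^{T_0} = 1` (hence `A_j^{T_1} = 1`) and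
`A_j^{T_m} = A_j^{T_{m-1}} ∏_k (J_{m,j} - c_k) / (c_m - c_k)`, with `k` running through the addable
nodes of `T_{m-1}` other than the node filled with `m`. The factors commute, being polynomials in
`J_{m,j}`; the product is formed in `ℂ[X]` and evaluated at `J_{m,j}`. -/
noncomputable def idempotent (n : ℕ) (q : ℂ) (j : ℕ) :
    {m : ℕ} → StandardTableau m → HeckeAlgebra n q
  | 0, _ => 1
  | m + 1, T =>
      idempotent n q j T.init *
        Polynomial.aeval (jucysMurphy n q j m)
          (∏ β ∈ (addableNodes T.init.shape).erase (T.node (Fin.last m)),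
            Polynomial.C (content q T (Fin.last m) - nodeContent q β)⁻¹ *
              (Polynomial.X - Polynomial.C (nodeContent q β)))

/-- The projected fused operator
`X_{j,+}^{T}(x) = A_{j+1}^{T} X_j(x c_1) X_{j+1}(x c_2) ⋯ X_{j+m-1}(x c_m)`. -/
noncomputable def fusedPlus (n : ℕ) (q : ℂ) {m : ℕ} (T : StandardTableau m) (j : ℕ) (x : ℂ) :
    HeckeAlgebra n q :=
  idempotent n q (j + 1) T * baxterRight n q j (fun k => x * content q T k)

/-- The projected fused operator
`X_{j,-}^{T}(x) = A_j^{T} X_{j+m-1}(x / c_m) X_{j+m-2}(x / c_{m-1}) ⋯ X_j(x / c_1)`. -/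
noncomputable def fusedMinus (n : ℕ) (q : ℂ) {m : ℕ} (T : StandardTableau m) (j : ℕ) (x : ℂ) :
    HeckeAlgebra n q :=
  idempotent n q j T * baxterLeft n q j (fun k => x / content q T k.rev)

end BaxterizedHecke

namespace BaxterizedHecke

/-! ### Elements satisfying the Hecke relations -/

/-! Without idempotents, all three equations hold for arbitrary parameters `c`: they follow from the
Yang–Baxter equation by induction on `m`. What remains is to absorb the second idempotent on each
side: `A_{j+1} X→ A_j = A_{j+1} X→` and `A_j X← A_{j+1} = A_j X←`. The leading idempotent then moves
past the single Baxterized factor, because their generators commute.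

The descending case rests on a factorization (`idempotent_mul_fusedDesc`). Put `D = σ_{j+m-1} ⋯ σ_j`
and let `D'` be the same product of inverses. Then `A_j ∏ (a c_i σ - b σ⁻¹)`, in descending order,
is up to scalars `A_j (a D - b D')`. Both `D` and `D'` intertwine `A_{j+1}` with `A_j`, so the
right-hand side absorbs `A_{j+1}`. In the ascending case, the ascending product inverts the
descending one up to a scalar, and `a D - b D'` has to be cancelled. This is done with a polynomial
indeterminate `a = X`, `b = 1`, where the constant term `-D'` is invertible; evaluation then gives
every admissible `x`.

The factorization needs `J_{i,j} A_j = c_i A_j`. It is proved without representation theory, from a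
characteristic identity (`IsHecke.exists_annihilator`): on vectors whose first weights are the
contents of a growing diagram, the next Jucys–Murphy element is annihilated by a product over
contents of addable nodes. Intertwiners exchange neighbouring weights. A quadratic relation gives
the candidate eigenvalues, and a weight pattern `a, b, a` with `a = q^{±2} b` is excluded by the
braid relation (`IsHecke.eq_zero_of_corner_return`). -/

/-- The elements `s 0, …, s (N - 1)` of a `ℂ`-algebra satisfy the relations of the Hecke algebra. -/
structure IsHecke {R : Type*} [Ring R] [Algebra ℂ R] (q : ℂ) (N : ℕ) (s : ℕ → R) : Prop where
  quad : ∀ i, i < N → s i * s i = 1 + (q - q⁻¹) • s i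
  braid : ∀ i, i + 1 < N → s i * s (i + 1) * s i = s (i + 1) * s i * s (i + 1)
  comm : ∀ i k, i + 1 < k → k < N → Commute (s i) (s k)

/-- The Jucys-Murphy elements built from a sequence of generators. -/
def jm {R : Type*} [Ring R] (s : ℕ → R) : ℕ → R
  | 0 => 1
  | k + 1 => s k * jm s k * s k

/-- The product `r (k - 1) ⋯ r 1 r 0`. -/
def descProd {R : Type*} [Ring R] (r : ℕ → R) : ℕ → R
  | 0 => 1
  | k + 1 => r k * descProd r k

/-- The intertwiner of the consecutive Jucys-Murphy elements with indices `k` and `k + 1`. -/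
noncomputable def intertwiner {R : Type*} [Ring R] [Algebra ℂ R] (q : ℂ) (s : ℕ → R) (k : ℕ) : R :=
  s k * (jm s (k + 1) - jm s k) - (q - q⁻¹) • jm s (k + 1)

section Ring

variable {R : Type*} [Ring R]

theorem commute_jm_of_forall {s : ℕ → R} {h : R} {k : ℕ} (hs : ∀ i < k, Commute h (s i)) :
    Commute h (jm s k) := by
  induction k with
  | zero => exact Commute.one_right h
  | succ k ih =>
    have h1 := ih fun i hi => hs i (by omega)
    exact ((hs k (by omega)).mul_right h1).mul_right (hs k (by omega))

theorem commute_descProd_of_forall {r : ℕ → R} {h : R} {k : ℕ} (hs : ∀ i < k, Commute h (r i)) :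
    Commute h (descProd r k) := by
  induction k with
  | zero => exact Commute.one_right h
  | succ k ih => exact (hs k (by omega)).mul_right (ih fun i hi => hs i (by omega))

/-- Only the factors `r (i + 1) * r i` meet `s (i + 1)` nontrivially, and `hbraid` lowers its index
there. Keeping `r` apart from `s` covers both `r = s` and the inverses of `s`. -/
theorem descProd_mul_shift {r s : ℕ → R} {k : ℕ}
    (hcomm : ∀ i l, i + 1 < l → l < k → Commute (r l) (s i))
    (hcomm' : ∀ i l, i + 1 < l → l < k → Commute (s l) (r i))
    (hbraid : ∀ i, i + 1 < k → r (i + 1) * r i * s (i + 1) = s i * r (i + 1) * r i)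
    {i : ℕ} (hi : i + 1 < k) :
    descProd r k * s (i + 1) = s i * descProd r k := by
  induction k with
  | zero => omega
  | succ k ih =>
    rcases (Nat.lt_succ_iff.1 hi).lt_or_eq with h | rfl
    · have h1 := ih (fun i l h1 h2 => hcomm i l h1 (by omega))
        (fun i l h1 h2 => hcomm' i l h1 (by omega)) (fun i h1 => hbraid i (by omega)) h
      have h2 := (hcomm i k h (by omega)).eq
      simp only [descProd]
      rw [mul_assoc, h1, ← mul_assoc, h2, mul_assoc]
    · have h1 : Commute (s (i + 1)) (descProd r i) :=
        commute_descProd_of_forall fun l hl => hcomm' l (i + 1) (by omega) (by omega)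
      simp only [descProd]
      rw [mul_assoc, mul_assoc, ← h1.eq, ← mul_assoc, ← mul_assoc, hbraid i (by omega)]
      simp only [mul_assoc]

theorem mul_jm_of_forall {s s' : ℕ → R} {d : R} {k : ℕ} (h : ∀ i < k, d * s' i = s i * d) :
    d * jm s' k = jm s k * d := by
  induction k with
  | zero => simp [jm]
  | succ k ih =>
    have h1 := ih fun i hi => h i (by omega)
    have h2 := h k (by omega)
    simp only [jm]
    rw [← mul_assoc, ← mul_assoc, h2, mul_assoc (s k) d, h1, mul_assoc, mul_assoc, h2]
    simp only [mul_assoc]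

end Ring

/-! ### Commutation relations of Jucys–Murphy elements and intertwiners -/

namespace IsHecke

variable {R : Type*} [Ring R] [Algebra ℂ R] {q : ℂ} {N : ℕ} {s : ℕ → R}

theorem mul_inv (hs : IsHecke q N s) {i : ℕ} (hi : i < N) :
    s i * (s i - (q - q⁻¹) • 1) = 1 := by
  rw [mul_sub, hs.quad i hi, mul_smul_comm, mul_one, add_sub_cancel_right]

theorem inv_mul (hs : IsHecke q N s) {i : ℕ} (hi : i < N) :
    (s i - (q - q⁻¹) • 1) * s i = 1 := by
  rw [sub_mul, hs.quad i hi, smul_mul_assoc, one_mul, add_sub_cancel_right]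

theorem commute_jm_lt (hs : IsHecke q N s) {i k : ℕ} (hi : i + 1 < k) (hk : k ≤ N) :
    Commute (s i) (jm s k) := by
  induction k with
  | zero => omega
  | succ k ih =>
    rcases (Nat.lt_succ_iff.1 hi).lt_or_eq with h | rfl
    · have h1 := hs.comm i k h (by omega)
      exact (h1.mul_right (ih h (by omega))).mul_right h1
    · have hb := hs.braid i (by omega)
      have h1 : Commute (s (i + 1)) (jm s i) :=
        commute_jm_of_forall fun l hl => (hs.comm l (i + 1) (by omega) (by omega)).symm
      show s i * (s (i + 1) * (s i * jm s i * s i) * s (i + 1)) =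
        s (i + 1) * (s i * jm s i * s i) * s (i + 1) * s i
      calc s i * (s (i + 1) * (s i * jm s i * s i) * s (i + 1))
          = (s i * s (i + 1) * s i) * jm s i * s i * s (i + 1) := by simp only [mul_assoc]
        _ = s (i + 1) * s i * (s (i + 1) * jm s i) * s i * s (i + 1) := by
          rw [hb]; simp only [mul_assoc]
        _ = s (i + 1) * s i * jm s i * (s (i + 1) * s i * s (i + 1)) := by
          rw [h1.eq]; simp only [mul_assoc]
        _ = _ := by rw [← hb]; simp only [mul_assoc]

theorem commute_jm_gt (hs : IsHecke q N s) {i k : ℕ} (hi : k < i) (hk : i < N) :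
    Commute (s i) (jm s k) :=
  commute_jm_of_forall fun l hl => (hs.comm l i (by omega) hk).symm

theorem commute_jm_jm (hs : IsHecke q N s) {k l : ℕ} (hk : k ≤ N) (hl : l ≤ N) :
    Commute (jm s k) (jm s l) := by
  wlog h : k ≤ l generalizing k l
  · exact (this hl hk (by omega)).symm
  rcases h.lt_or_eq with h | rfl
  · exact (commute_jm_of_forall fun i hi => (hs.commute_jm_lt (by omega) hl).symm).symm
  · exact Commute.refl _

/-- `σ J_k = J_{k+1} σ⁻¹`. -/
theorem mul_jm (hs : IsHecke q N s) {k : ℕ} (hk : k < N) :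
    s k * jm s k = jm s (k + 1) * s k - (q - q⁻¹) • jm s (k + 1) := by
  have h := hs.mul_inv hk
  calc s k * jm s k = s k * jm s k * (s k * (s k - (q - q⁻¹) • 1)) := by rw [h, mul_one]
    _ = jm s (k + 1) * (s k - (q - q⁻¹) • 1) := by simp only [jm, mul_assoc]
    _ = _ := by rw [mul_sub, mul_smul_comm, mul_one]

theorem jm_mul (hs : IsHecke q N s) {k : ℕ} (hk : k < N) :
    jm s k * s k = s k * jm s (k + 1) - (q - q⁻¹) • jm s (k + 1) := by
  have h := hs.inv_mul hk
  calc jm s k * s k = ((s k - (q - q⁻¹) • 1) * s k) * (jm s k * s k) := by rw [h, one_mul]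
    _ = (s k - (q - q⁻¹) • 1) * jm s (k + 1) := by simp only [jm, mul_assoc]
    _ = _ := by rw [sub_mul, smul_mul_assoc, one_mul]

theorem jm_mul_intertwiner (hs : IsHecke q N s) {k : ℕ} (hk : k < N) :
    jm s k * intertwiner q s k = intertwiner q s k * jm s (k + 1) := by
  have h1 := hs.jm_mul hk
  have hc := (hs.commute_jm_jm (k := k) (l := k + 1) (by omega) (by omega)).eq
  simp only [intertwiner, mul_sub, sub_mul, mul_smul_comm, smul_mul_assoc]
  rw [← mul_assoc, h1, ← mul_assoc, h1, hc]
  simp only [sub_mul, smul_mul_assoc, mul_assoc, hc]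
  abel

theorem jm_succ_mul_intertwiner (hs : IsHecke q N s) {k : ℕ} (hk : k < N) :
    jm s (k + 1) * intertwiner q s k = intertwiner q s k * jm s k := by
  have h1 : jm s (k + 1) * s k = s k * jm s k + (q - q⁻¹) • jm s (k + 1) := by
    rw [hs.mul_jm hk]; abel
  have hc := (hs.commute_jm_jm (k := k) (l := k + 1) (by omega) (by omega)).eq
  simp only [intertwiner, mul_sub, sub_mul, mul_smul_comm, smul_mul_assoc]
  rw [← mul_assoc, h1, ← mul_assoc, h1]
  simp only [add_mul, smul_mul_assoc, mul_assoc, hc]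
  abel

/-- The square no longer involves `s k`, so it acts on a joint eigenvector by a scalar; this decides
when the intertwiner cannot kill the vector. -/
theorem intertwiner_mul_self (hs : IsHecke q N s) {k : ℕ} (hk : k < N) :
    intertwiner q s k * intertwiner q s k =
      (q - q⁻¹) ^ 2 • (jm s k * jm s (k + 1)) -
        (jm s (k + 1) - jm s k) * (jm s (k + 1) - jm s k) := by
  have h1 := hs.jm_mul_intertwiner hk
  have h2 := hs.jm_succ_mul_intertwiner hk
  have hc := (hs.commute_jm_jm (k := k) (l := k + 1) (by omega) (by omega)).eq
  have hq := hs.quad k hk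
  have h3 : intertwiner q s k * intertwiner q s k =
      s k * intertwiner q s k * (jm s k - jm s (k + 1)) -
        (q - q⁻¹) • (intertwiner q s k * jm s k) := by
    conv_lhs => enter [1]; rw [intertwiner]
    rw [sub_mul, smul_mul_assoc, h2, mul_assoc, sub_mul, h1, h2, ← mul_sub, mul_assoc]
  rw [h3]
  simp only [intertwiner]
  have h4 : s k * (s k * (jm s (k + 1) - jm s k) - (q - q⁻¹) • jm s (k + 1)) =
      (1 + (q - q⁻¹) • s k) * (jm s (k + 1) - jm s k) - (q - q⁻¹) • (s k * jm s (k + 1)) := by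
    rw [mul_sub, ← mul_assoc, hq, mul_smul_comm]
  rw [h4]
  generalize q - q⁻¹ = t
  simp only [mul_sub, sub_mul, add_mul, one_mul, smul_mul_assoc, smul_sub, mul_assoc,
    pow_two, mul_smul, hc]
  abel

end IsHecke

/-! ### Addable nodes and growing lists of nodes -/

/-- A node can be added to a set of nodes if it lies outside and the enlarged set is a lower set. -/
def IsAddableTo (S : Set (ℕ × ℕ)) (β : ℕ × ℕ) : Prop :=
  β ∉ S ∧ IsLowerSet (insert β S)

/-- A list of nodes, the last one first, which are added one after the other to the empty
diagram. -/
def IsGrowth : List (ℕ × ℕ) → Prop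
  | [] => True
  | β :: L => IsAddableTo {x | x ∈ L} β ∧ IsGrowth L

/-- The diagonal of a node. -/
def diag (α : ℕ × ℕ) : ℤ := (α.2 : ℤ) - α.1

theorem setOf_mem_cons (β : ℕ × ℕ) (L : List (ℕ × ℕ)) :
    {x | x ∈ β :: L} = insert β {x | x ∈ L} := by
  ext x; simp

theorem IsGrowth.isLowerSet {L : List (ℕ × ℕ)} (hL : IsGrowth L) : IsLowerSet {x | x ∈ L} := by
  cases L with
  | nil => intro a b _ h; simp at h
  | cons β L => rw [setOf_mem_cons]; exact hL.1.2

theorem IsAddableTo.mem_of_le {S : Set (ℕ × ℕ)} {α β : ℕ × ℕ} (hβ : IsAddableTo S β) (h : α ≤ β)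
    (hne : α ≠ β) : α ∈ S :=
  (hβ.2 h (Set.mem_insert _ _)).resolve_left hne

theorem IsAddableTo.not_le {S : Set (ℕ × ℕ)} {β γ : ℕ × ℕ} (hβ : IsAddableTo S β)
    (hγ : IsAddableTo S γ) (hne : β ≠ γ) : ¬β ≤ γ :=
  fun h => hβ.1 (hγ.mem_of_le h hne)

/-- Distinct addable nodes are incomparable, so one is strictly lower and strictly further left, and
each coordinate contributes at least one to the gap. -/
theorem IsAddableTo.diag_far {S : Set (ℕ × ℕ)} {β γ : ℕ × ℕ} (hβ : IsAddableTo S β)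
    (hγ : IsAddableTo S γ) (hne : β ≠ γ) :
    diag β + 2 ≤ diag γ ∨ diag γ + 2 ≤ diag β := by
  have h1 := hβ.not_le hγ hne
  have h2 := hγ.not_le hβ hne.symm
  rw [Prod.le_def] at h1 h2
  simp only [diag]
  omega

theorem IsAddableTo.insert {S : Set (ℕ × ℕ)} {β γ : ℕ × ℕ} (hβ : IsAddableTo S β)
    (hγ : IsAddableTo S γ) (hne : γ ≠ β) : IsAddableTo (insert β S) γ := by
  refine ⟨fun h => ?_, ?_⟩
  · exact h.elim hne hγ.1
  · rw [Set.insert_comm, Set.insert_eq, Set.insert_eq γ S]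
    have h : ({β} ∪ ({γ} ∪ S) : Set (ℕ × ℕ)) = Insert.insert β S ∪ Insert.insert γ S := by
      ext x; simp
    rw [h]
    exact hβ.2.union hγ.2

theorem isAddableTo_of_forall_le {S : Set (ℕ × ℕ)} {γ : ℕ × ℕ} (hS : IsLowerSet S) (hγ : γ ∉ S)
    (h : ∀ x, x ≤ γ → x = γ ∨ x ∈ S) : IsAddableTo S γ := by
  refine ⟨hγ, ?_⟩
  intro a b hba ha
  rcases ha with rfl | ha
  · exact h b hba
  · exact Or.inr (hS hba ha)

/-- The candidate `γ` is the right neighbour of `β`. It fails to be addable only if the node above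
it is missing, and then the node above `β` is a corner of `S`. -/
theorem exists_corner_right {S : Set (ℕ × ℕ)} {β : ℕ × ℕ} (hβ : IsAddableTo S β)
    (hS : IsLowerSet S)
    (h : ¬∃ γ, IsAddableTo (insert β S) γ ∧ diag γ = diag β + 1) :
    ∃ ρ ∈ S, (∀ x ∈ S, ρ ≤ x → x = ρ) ∧ diag ρ = diag β + 1 := by
  obtain ⟨r, k⟩ := β
  have hr : ¬(r = 0 ∨ (r - 1, k + 1) ∈ S) := by
    intro hr
    refine h ⟨(r, k + 1), isAddableTo_of_forall_le hβ.2 ?_ ?_, by simp [diag]; ring⟩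
    · rintro (h1 | h1)
      · simp at h1
      · exact hβ.1 (hS (show (r, k) ≤ (r, k + 1) from ⟨le_rfl, Nat.le_succ k⟩) h1)
    · rintro ⟨a, b⟩ ⟨h1, h2⟩
      simp only at h1 h2
      by_cases hb : b = k + 1
      · subst hb
        by_cases ha : a = r
        · exact Or.inl (by rw [ha])
        · right; right
          rcases hr with hr | hr
          · omega
          · exact hS (show (a, k + 1) ≤ (r - 1, k + 1) from ⟨by simp only; omega, le_rfl⟩) hr
      · exact Or.inr (hβ.2 (show (a, b) ≤ (r, k) from ⟨h1, by simp only; omega⟩)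
          (Set.mem_insert _ _))
  rw [not_or] at hr
  have hr0 := hr.1
  refine ⟨(r - 1, k), hβ.mem_of_le ⟨by simp, le_rfl⟩ (by simp; omega), ?_, ?_⟩
  · rintro ⟨a, b⟩ hx ⟨h1, h2⟩
    simp only at h1 h2
    have ha : a < r := by
      by_contra ha
      exact hβ.1 (hS (show (r, k) ≤ (a, b) from ⟨by simp only; omega, h2⟩) hx)
    have hb : b < k + 1 := by
      by_contra hb
      exact hr.2 (hS (show (r - 1, k + 1) ≤ (a, b) from ⟨h1, by simp only; omega⟩) hx)
    ext <;> simp only <;> omega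
  · simp only [diag]; omega

/-- The transpose of `exists_corner_right`. -/
theorem exists_corner_below {S : Set (ℕ × ℕ)} {β : ℕ × ℕ} (hβ : IsAddableTo S β)
    (hS : IsLowerSet S)
    (h : ¬∃ γ, IsAddableTo (insert β S) γ ∧ diag γ = diag β - 1) :
    ∃ ρ ∈ S, (∀ x ∈ S, ρ ≤ x → x = ρ) ∧ diag ρ = diag β - 1 := by
  obtain ⟨k, r⟩ := β
  have hr : ¬(r = 0 ∨ (k + 1, r - 1) ∈ S) := by
    intro hr
    refine h ⟨(k + 1, r), isAddableTo_of_forall_le hβ.2 ?_ ?_, by simp [diag]; ring⟩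
    · rintro (h1 | h1)
      · simp at h1
      · exact hβ.1 (hS (show (k, r) ≤ (k + 1, r) from ⟨Nat.le_succ k, le_rfl⟩) h1)
    · rintro ⟨b, a⟩ ⟨h2, h1⟩
      simp only at h1 h2
      by_cases hb : b = k + 1
      · subst hb
        by_cases ha : a = r
        · exact Or.inl (by rw [ha])
        · right; right
          rcases hr with hr | hr
          · omega
          · exact hS (show (k + 1, a) ≤ (k + 1, r - 1) from ⟨le_rfl, by simp only; omega⟩) hr
      · exact Or.inr (hβ.2 (show (b, a) ≤ (k, r) from ⟨by simp only; omega, h1⟩)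
          (Set.mem_insert _ _))
  rw [not_or] at hr
  have hr0 := hr.1
  refine ⟨(k, r - 1), hβ.mem_of_le ⟨le_rfl, by simp⟩ (by simp; omega), ?_, ?_⟩
  · rintro ⟨b, a⟩ hx ⟨h2, h1⟩
    simp only at h1 h2
    have ha : a < r := by
      by_contra ha
      exact hβ.1 (hS (show (k, r) ≤ (b, a) from ⟨h2, by simp only; omega⟩) hx)
    have hb : b < k + 1 := by
      by_contra hb
      exact hr.2 (hS (show (k + 1, r - 1) ≤ (b, a) from ⟨by simp only; omega, h1⟩) hx)
    ext <;> simp only <;> omega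
  · simp only [diag]; omega

/-! ### Quantum contents -/

theorem zpow_inj_of_not_root {q : ℂ} (hq0 : q ≠ 0) (hq : ∀ k : ℕ, 0 < k → q ^ k ≠ 1) {a b : ℤ}
    (h : q ^ a = q ^ b) : a = b := by
  wlog hab : a ≤ b generalizing a b
  · exact (this h.symm (by omega)).symm
  by_contra hne
  have h1 : q ^ (b - a) = 1 := by
    rw [zpow_sub₀ hq0, h, div_self (zpow_ne_zero _ hq0)]
  obtain ⟨k, hk⟩ := Int.eq_ofNat_of_zero_le (show 0 ≤ b - a by omega)
  rw [hk, zpow_natCast] at h1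
  exact hq k (by omega) h1

theorem nodeContent_ne_zero {q : ℂ} (hq0 : q ≠ 0) (α : ℕ × ℕ) : nodeContent q α ≠ 0 :=
  zpow_ne_zero _ hq0

theorem diag_eq_of_nodeContent_eq {q : ℂ} (hq0 : q ≠ 0) (hq : ∀ k : ℕ, 0 < k → q ^ k ≠ 1)
    {α γ : ℕ × ℕ} (h : nodeContent q α = nodeContent q γ) : diag α = diag γ := by
  have := zpow_inj_of_not_root hq0 hq h
  simp only [diag]
  omega

theorem nodeContent_of_diag_eq_add {q : ℂ} (hq0 : q ≠ 0) {α γ : ℕ × ℕ} {e : ℤ}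
    (h : diag γ = diag α + e) : nodeContent q γ = q ^ (2 * e) * nodeContent q α := by
  simp only [nodeContent]
  rw [← zpow_add₀ hq0]
  congr 1
  simp only [diag] at h
  omega

theorem sub_inv_ne_zero {q : ℂ} (hq0 : q ≠ 0) (hq : ∀ k : ℕ, 0 < k → q ^ k ≠ 1) :
    q - q⁻¹ ≠ 0 := by
  intro h
  refine hq 2 (by norm_num) ?_
  rw [sub_eq_zero] at h
  rw [pow_two]
  nth_rewrite 2 [h]
  exact mul_inv_cancel₀ hq0

/-- This is the scalar by which the squared intertwiner acts on weights `a, b`; for contents it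
vanishes exactly on adjacent diagonals. -/
theorem lambda_sq_factor {q : ℂ} (hq0 : q ≠ 0) (a b : ℂ) :
    (q - q⁻¹) ^ 2 * (a * b) - (b - a) ^ 2 =
      -((b - q ^ (2 : ℤ) * a) * (b - q ^ (-2 : ℤ) * a)) := by
  have h : q ^ (-2 : ℤ) = q⁻¹ ^ 2 := by rw [zpow_neg, inv_pow]; rfl
  rw [h, show q ^ (2 : ℤ) = q ^ 2 from rfl]
  field_simp
  ring

/-! ### Joint eigenvectors of the Jucys-Murphy elements -/

/-- The Jucys-Murphy elements act on `v` from the left by the given list of eigenvalues, the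
last one first. -/
def HasWeights {R : Type*} [Ring R] [Algebra ℂ R] (s : ℕ → R) : List ℂ → R → Prop
  | [], _ => True
  | a :: L, v => jm s L.length * v = a • v ∧ HasWeights s L v

section

variable {R : Type*} [Ring R] [Algebra ℂ R] {q : ℂ} {N : ℕ} {s : ℕ → R}

theorem aeval_mul_of_eigen {y v : R} {a : ℂ} (h : y * v = a • v) (p : Polynomial ℂ) :
    Polynomial.aeval y p * v = p.eval a • v := by
  induction p using Polynomial.induction_on' with
  | add p r hp hr => rw [map_add, add_mul, hp, hr, Polynomial.eval_add, add_smul]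
  | monomial k c =>
    have hk : y ^ k * v = a ^ k • v := by
      induction k with
      | zero => simp
      | succ k ih => rw [pow_succ, mul_assoc, h, mul_smul_comm, ih, smul_smul, pow_succ, mul_comm]
    rw [Polynomial.aeval_monomial, Polynomial.eval_monomial, mul_assoc, hk, mul_smul_comm,
      ← Algebra.smul_def, smul_smul, mul_comm]

theorem aeval_mul_of_mul_eq {y y' d : R} (h : y * d = d * y') (p : Polynomial ℂ) :
    Polynomial.aeval y p * d = d * Polynomial.aeval y' p := by
  induction p using Polynomial.induction_on' with
  | add p r hp hr => rw [map_add, add_mul, hp, hr, map_add, mul_add]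
  | monomial k c =>
    have hk : y ^ k * d = d * y' ^ k := by
      induction k with
      | zero => simp
      | succ k ih => rw [pow_succ, mul_assoc, h, ← mul_assoc, ih, mul_assoc, pow_succ]
    rw [Polynomial.aeval_monomial, Polynomial.aeval_monomial, mul_assoc, hk, ← mul_assoc,
      Algebra.commutes, mul_assoc]

theorem HasWeights.mul_left {L : List ℂ} {v h : R} (hv : HasWeights s L v)
    (hc : ∀ k < L.length, Commute h (jm s k)) : HasWeights s L (h * v) := by
  induction L with
  | nil => trivial
  | cons a L ih =>
    simp only [List.length_cons] at hc
    refine ⟨?_, ih hv.2 fun k hk => hc k (by omega)⟩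
    rw [← mul_assoc, ← (hc L.length (by omega)).eq, mul_assoc, hv.1, mul_smul_comm]

theorem HasWeights.mul_right {L : List ℂ} {v : R} (hv : HasWeights s L v) (h : R) :
    HasWeights s L (v * h) := by
  induction L with
  | nil => trivial
  | cons a L ih => exact ⟨by rw [← mul_assoc, hv.1, smul_mul_assoc], ih hv.2⟩

theorem HasWeights.of_append {E L : List ℂ} {v : R} (hv : HasWeights s (E ++ L) v) :
    HasWeights s L v := by
  induction E with
  | nil => exact hv
  | cons a E ih => exact ih hv.2

namespace IsHecke

theorem commute_intertwiner_jm (hs : IsHecke q N s) {k l : ℕ} (hk : k < N) (hl : l ≤ N)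
    (h : l < k ∨ k + 1 < l) : Commute (intertwiner q s k) (jm s l) := by
  have h1 : Commute (s k) (jm s l) := by
    rcases h with h | h
    · exact hs.commute_jm_gt h hk
    · exact hs.commute_jm_lt h hl
  have h2 := hs.commute_jm_jm (k := k) (by omega) hl
  have h3 := hs.commute_jm_jm (k := k + 1) (by omega) hl
  exact (h1.mul_left (h3.sub_left h2)).sub_left (h3.smul_left _)

/-- The intertwiner exchanges two consecutive Jucys–Murphy elements and commutes with the others.
The result may be zero, so nonvanishing is always argued separately. -/
theorem hasWeights_swap (hs : IsHecke q N s) {E L : List ℂ} {a b : ℂ} {v : R}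
    (hv : HasWeights s (E ++ b :: a :: L) v) (hlen : (E ++ b :: a :: L).length ≤ N + 1) :
    HasWeights s (E ++ a :: b :: L) (intertwiner q s L.length * v) := by
  induction E with
  | nil =>
    simp only [List.nil_append, List.length_cons] at hlen
    have h1 := hv.1
    have h2 := hv.2.1
    refine ⟨?_, ?_, hv.2.2.mul_left fun k hk =>
      hs.commute_intertwiner_jm (by omega) (by omega) (Or.inl hk)⟩
    · simp only [List.length_cons]
      rw [← mul_assoc, hs.jm_succ_mul_intertwiner (by omega), mul_assoc, h2, mul_smul_comm]
    · rw [← mul_assoc, hs.jm_mul_intertwiner (by omega), mul_assoc]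
      rw [List.length_cons] at h1
      rw [h1, mul_smul_comm]
  | cons e E ih =>
    simp only [List.cons_append, List.length_cons, List.length_append] at hlen ih
    refine ⟨?_, ih hv.2 (by omega)⟩
    have hl : (E ++ a :: b :: L).length = (E ++ b :: a :: L).length := by simp
    have h1 : jm s (E ++ b :: a :: L).length * v = e • v := hv.1
    show jm s (E ++ a :: b :: L).length * _ = _
    rw [hl, ← mul_assoc, ← (hs.commute_intertwiner_jm (k := L.length) (by omega)
      (by simp; omega) (Or.inr (by simp; omega))).eq, mul_assoc, h1, mul_smul_comm]

theorem intertwiner_sq_mul (hs : IsHecke q N s) (hq0 : q ≠ 0) {k : ℕ} (hk : k < N) {a b : ℂ}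
    {v : R} (ha : jm s k * v = a • v) (hb : jm s (k + 1) * v = b • v) :
    intertwiner q s k * (intertwiner q s k * v) =
      -((b - q ^ (2 : ℤ) * a) * (b - q ^ (-2 : ℤ) * a)) • v := by
  rw [← lambda_sq_factor hq0, ← mul_assoc, hs.intertwiner_mul_self hk]
  have h1 : (jm s (k + 1) - jm s k) * v = (b - a) • v := by rw [sub_mul, ha, hb, sub_smul]
  rw [sub_mul, smul_mul_assoc, mul_assoc, mul_assoc, hb, h1, mul_smul_comm, mul_smul_comm, h1, ha,
    smul_smul, smul_smul, smul_smul, ← sub_smul]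
  congr 1
  ring

theorem smul_generator_mul {k : ℕ} {a b : ℂ} {v : R}
    (ha : jm s k * v = a • v) (hb : jm s (k + 1) * v = b • v) (hv : intertwiner q s k * v = 0) :
    (b - a) • (s k * v) = ((q - q⁻¹) * b) • v := by
  rw [intertwiner, sub_mul, sub_eq_zero, smul_mul_assoc, mul_assoc, sub_mul, ha, hb, ← sub_smul,
    mul_smul_comm, smul_smul] at hv
  exact hv

end IsHecke

/-! ### Possible eigenvalues -/

theorem far_smul_ne_zero (hq0 : q ≠ 0) (hq : ∀ k : ℕ, 0 < k → q ^ k ≠ 1) {β γ : ℕ × ℕ}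
    (h : diag β + 2 ≤ diag γ ∨ diag γ + 2 ≤ diag β) :
    -((nodeContent q γ - q ^ (2 : ℤ) * nodeContent q β) *
      (nodeContent q γ - q ^ (-2 : ℤ) * nodeContent q β)) ≠ 0 := by
  have key : ∀ e : ℤ, 2 * diag γ ≠ 2 * diag β + e →
      nodeContent q γ - q ^ e * nodeContent q β ≠ 0 := by
    intro e he h0
    rw [sub_eq_zero] at h0
    simp only [nodeContent] at h0
    rw [← zpow_add₀ hq0] at h0
    have := zpow_inj_of_not_root hq0 hq h0
    simp only [diag] at he
    omega
  rw [neg_ne_zero]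
  exact mul_ne_zero (key 2 (by omega)) (key (-2) (by omega))

/-- A corner can be made the last node added: each exchange on the way involves two nodes addable to
one diagram, so their diagonals are far apart and the intertwiner keeps the vector nonzero. The list
`E` holds the weights after those of `L`, which stay unchanged. -/
theorem IsHecke.exists_move_corner (hs : IsHecke q N s) (hq0 : q ≠ 0)
    (hq : ∀ k : ℕ, 0 < k → q ^ k ≠ 1) {L : List (ℕ × ℕ)} (hL : IsGrowth L) {ρ : ℕ × ℕ}
    (hρ : ρ ∈ L) (hmax : ∀ x ∈ L, ρ ≤ x → x = ρ) {E : List ℂ} {v : R} (hv0 : v ≠ 0)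
    (hlen : (E ++ L.map (nodeContent q)).length ≤ N + 1)
    (hv : HasWeights s (E ++ L.map (nodeContent q)) v) :
    ∃ L' : List (ℕ × ℕ), IsGrowth (ρ :: L') ∧ (∀ x, x ∈ ρ :: L' ↔ x ∈ L) ∧
      (ρ :: L').length = L.length ∧
      ∃ v' : R, v' ≠ 0 ∧ HasWeights s (E ++ (ρ :: L').map (nodeContent q)) v' := by
  induction L generalizing E v with
  | nil => simp at hρ
  | cons β L ih =>
    by_cases hβρ : ρ = β
    · subst hβρ
      exact ⟨L, hL, fun x => Iff.rfl, rfl, v, hv0, hv⟩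
    · have hρL : ρ ∈ L := by simpa [hβρ] using hρ
      obtain ⟨L', hL', hmem, hl, v', hv'0, hv'⟩ := ih hL.2 hρL
        (fun x hx => hmax x (List.mem_cons_of_mem _ hx)) (E := E ++ [nodeContent q β]) hv0
        (by simpa using hlen) (by simpa using hv)
      have hlen' := hlen
      simp only [List.length_append, List.length_map, List.length_cons] at hlen' hl
      have hset : {x | x ∈ ρ :: L'} = {x | x ∈ L} := Set.ext hmem
      have hset' : {x | x ∈ L} = insert ρ {x | x ∈ L'} := by rw [← hset, setOf_mem_cons]
      have hβL : IsAddableTo {x | x ∈ L} β := hL.1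
      have hρ1 : IsAddableTo {x | x ∈ L'} ρ := hL'.1
      -- Maximality of `ρ` prevents `β` from depending on it.
      have hβL' : IsAddableTo {x | x ∈ L'} β := by
        refine isAddableTo_of_forall_le hL'.2.isLowerSet (fun h => hβL.1 ?_) fun x hx => ?_
        · rw [hset']; exact Or.inr h
        · by_cases hxβ : x = β
          · exact Or.inl hxβ
          · right
            have h := hβL.mem_of_le hx hxβ
            rw [hset'] at h
            refine h.resolve_left ?_
            rintro rfl
            exact hβρ (hmax β List.mem_cons_self hx).symm
      have hfar := hρ1.diag_far hβL' hβρ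
      have hw : HasWeights s (nodeContent q β :: nodeContent q ρ :: L'.map (nodeContent q)) v' := by
        have h : HasWeights s (E ++ (nodeContent q β :: nodeContent q ρ :: L'.map (nodeContent q)))
          v' := by simpa using hv'
        exact h.of_append
      refine ⟨β :: L', ⟨?_, hβL', hL'.2⟩, ?_, by simp; omega,
        intertwiner q s (L'.map (nodeContent q)).length * v', ?_, ?_⟩
      · rw [setOf_mem_cons]
        exact hβL'.insert hρ1 hβρ
      · intro x
        have := hmem x
        simp only [List.mem_cons] at this ⊢
        rw [← this]
        tauto
      · intro h0
        have h1 := hs.intertwiner_sq_mul hq0 (k := (L'.map (nodeContent q)).length)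
          (by simp; omega) hw.2.1 hw.1
        rw [h0, mul_zero] at h1
        exact (smul_ne_zero (far_smul_ne_zero hq0 hq hfar) hv'0) h1.symm
      · have := hs.hasWeights_swap (E := E) (L := L'.map (nodeContent q)) (a := nodeContent q ρ)
          (b := nodeContent q β) (v := v') (by simpa using hv') (by simp; omega)
        simpa using this

/-- Whenever `v ≠ 0` has the contents of `L` as its first weights, the next eigenvalue is the
content of an addable node. -/
def NextWeightAddable (q : ℂ) (s : ℕ → R) (L : List (ℕ × ℕ)) : Prop :=
  ∀ (a : ℂ) (v : R), v ≠ 0 → HasWeights s (a :: L.map (nodeContent q)) v →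
    ∃ γ, IsAddableTo {x | x ∈ L} γ ∧ nodeContent q γ = a

/-- After moving `ρ` to the end of `L`, the last three weights are `a, b, a`. Either exchange would
produce weights forbidden by `ih`, so both intertwiners vanish on `w` and both generators act by
scalars, which the braid relation excludes. -/
theorem IsHecke.eq_zero_of_corner_return (hs : IsHecke q N s) (hq0 : q ≠ 0)
    (hq : ∀ k : ℕ, 0 < k → q ^ k ≠ 1) {L : List (ℕ × ℕ)} (hL : IsGrowth L) {β ρ : ℕ × ℕ}
    (hβ : IsAddableTo {x | x ∈ L} β) (hρ : ρ ∈ L) (hmax : ∀ x ∈ L, ρ ≤ x → x = ρ)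
    (hd : diag ρ = diag β + 1 ∨ diag ρ = diag β - 1) (hlen : L.length + 1 ≤ N)
    (ih : ∀ L', IsGrowth L' → L'.length ≤ L.length → NextWeightAddable q s L') {v : R}
    (hv : HasWeights s (nodeContent q ρ :: nodeContent q β :: L.map (nodeContent q)) v) :
    v = 0 := by
  by_contra hv0
  obtain ⟨L', hL', hmem, hl, w, hw0, hw⟩ := hs.exists_move_corner hq0 hq hL hρ hmax
    (E := [nodeContent q ρ, nodeContent q β]) hv0 (by simp; omega) hv
  simp only [List.length_cons] at hl
  set a := nodeContent q ρ with ha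
  set b := nodeContent q β with hb
  set K := L'.map (nodeContent q) with hK
  have hKl : K.length = L'.length := by simp [hK]
  replace hw : HasWeights s (a :: b :: a :: K) w := hw
  -- Otherwise `L'` could be followed by a node with content `b`, on a diagonal adjacent to that of
  -- its addable node `ρ`.
  have h1 : intertwiner q s K.length * w = 0 := by
    by_contra h0
    have h2 := hs.hasWeights_swap (E := []) (L := K) (a := a) (b := b) hw.2 (by simp; omega)
    obtain ⟨γ, hγ, hγb⟩ := ih L' hL'.2 (by omega) b _ h0 h2.2
    have h3 := diag_eq_of_nodeContent_eq hq0 hq hγb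
    have hne : γ ≠ ρ := by rintro rfl; omega
    have := hγ.diag_far hL'.1 hne
    omega
  -- Otherwise `L` could be followed by a node on the diagonal of `ρ`, adjacent to that of its
  -- addable node `β`.
  have h2 : intertwiner q s (K.length + 1) * w = 0 := by
    by_contra h0
    have h2 := hs.hasWeights_swap (E := []) (L := a :: K) (a := b) (b := a) hw (by simp; omega)
    obtain ⟨γ, hγ, hγb⟩ := ih (ρ :: L') hL' (by simp; omega) a _ h0 h2.2
    have h3 := diag_eq_of_nodeContent_eq hq0 hq hγb
    rw [show {x | x ∈ ρ :: L'} = {x | x ∈ L} from Set.ext hmem] at hγ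
    have hne : γ ≠ β := by rintro rfl; omega
    have := hγ.diag_far hβ hne
    omega
  have hab : b - a ≠ 0 := by
    intro h
    have := diag_eq_of_nodeContent_eq hq0 hq (sub_eq_zero.1 h)
    omega
  have hba : a - b ≠ 0 := by rw [← neg_sub]; exact neg_ne_zero.2 hab
  have e1 := IsHecke.smul_generator_mul hw.2.2.1 hw.2.1 h1
  have e2 := IsHecke.smul_generator_mul (k := K.length + 1) hw.2.1 hw.1 h2
  have f1 : s K.length * w = ((b - a)⁻¹ * ((q - q⁻¹) * b)) • w := by
    rw [mul_smul, ← e1, inv_smul_smul₀ hab]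
  have f2 : s (K.length + 1) * w = ((a - b)⁻¹ * ((q - q⁻¹) * a)) • w := by
    rw [mul_smul, ← e2, inv_smul_smul₀ hba]
  -- With scalars `f`, `g` for the two generators, this reads `f g f = g f g`, hence `f = g`, and
  -- then `a = -b`.
  have hbr := congrArg (· * w) (hs.braid K.length (by omega))
  simp only [mul_assoc, f1, f2, mul_smul_comm, smul_smul] at hbr
  have h3 := smul_left_injective ℂ hw0 hbr
  have hlam := sub_inv_ne_zero hq0 hq
  have ha0 : a ≠ 0 := nodeContent_ne_zero hq0 ρ
  have hb0 : b ≠ 0 := nodeContent_ne_zero hq0 β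
  have h4 : ((b - a)⁻¹ * ((q - q⁻¹) * b)) = ((a - b)⁻¹ * ((q - q⁻¹) * a)) := by
    have n1 : ((b - a)⁻¹ * ((q - q⁻¹) * b)) ≠ 0 :=
      mul_ne_zero (inv_ne_zero hab) (mul_ne_zero hlam hb0)
    have n2 : ((a - b)⁻¹ * ((q - q⁻¹) * a)) ≠ 0 :=
      mul_ne_zero (inv_ne_zero hba) (mul_ne_zero hlam ha0)
    refine mul_left_cancel₀ (mul_ne_zero n1 n2) ?_
    linear_combination h3
  have h5 : a = -b := by
    rw [← neg_sub b a, inv_neg] at h4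
    have h6 : (b - a)⁻¹ * (q - q⁻¹) ≠ 0 := mul_ne_zero (inv_ne_zero hab) hlam
    have : ((b - a)⁻¹ * (q - q⁻¹)) * (a + b) = 0 := by linear_combination h4
    linear_combination (mul_eq_zero.1 this).resolve_left h6
  -- Squaring removes the sign and leaves an equality of powers of `q`.
  have h6 : a * a = b * b := by rw [h5]; ring
  simp only [ha, hb, nodeContent, ← zpow_add₀ hq0] at h6
  have h7 := zpow_inj_of_not_root hq0 hq h6
  simp only [diag] at hd
  omega

/-- Linear factors without eigenvectors in the stable class `P` are injective on it. This strips
superfluous roots from an annihilating polynomial. -/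
theorem eq_zero_of_prod_eq_zero {y : R} {P : R → Prop} (B : Finset ℂ)
    (hP : ∀ (z : ℂ) (u : R), P u → P (Polynomial.aeval y (Polynomial.X - Polynomial.C z) * u))
    (hB : ∀ z ∈ B, ∀ u, P u → y * u = z • u → u = 0) {u : R} (hu : P u)
    (h : Polynomial.aeval y (∏ z ∈ B, (Polynomial.X - Polynomial.C z)) * u = 0) : u = 0 := by
  induction B using Finset.induction_on generalizing u with
  | empty => simpa using h
  | insert z B hz ih =>
    rw [Finset.prod_insert hz, mul_comm, map_mul, mul_assoc] at h
    have h1 := ih (fun z hz => hB z (Finset.mem_insert_of_mem hz)) (hP z u hu) h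
    refine hB z (Finset.mem_insert_self _ _) u hu ?_
    simpa [sub_mul, sub_eq_zero, ← Algebra.smul_def] using h1

/-- The characteristic identity of the Jucys-Murphy elements. -/
theorem IsHecke.exists_annihilator (hs : IsHecke q N s) (hq0 : q ≠ 0)
    (hq : ∀ k : ℕ, 0 < k → q ^ k ≠ 1) {L : List (ℕ × ℕ)} (hL : IsGrowth L) (hlen : L.length ≤ N) :
    ∃ Z : Finset ℂ, (∀ z ∈ Z, ∃ γ, IsAddableTo {x | x ∈ L} γ ∧ nodeContent q γ = z) ∧
      ∀ v : R, HasWeights s (L.map (nodeContent q)) v →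
        Polynomial.aeval (jm s L.length) (∏ z ∈ Z, (Polynomial.X - Polynomial.C z)) * v = 0 := by
  classical
  induction hn : L.length using Nat.strong_induction_on generalizing L with
  | _ n ih =>
  -- An eigenvalue on a nonzero vector is a root of the annihilating polynomial of the shorter list.
  have ih' : ∀ L' : List (ℕ × ℕ), IsGrowth L' → L'.length < n → NextWeightAddable q s L' := by
    intro L' hL' hl a v hv0 hv
    obtain ⟨Z, hZ, h⟩ := ih _ hl hL' (by omega) rfl
    have h1 := h v hv.2
    have h2 := hv.1
    rw [List.length_map] at h2
    rw [aeval_mul_of_eigen h2, Polynomial.eval_prod, smul_eq_zero] at h1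
    obtain ⟨z, hz, h3⟩ := Finset.prod_eq_zero_iff.1 (h1.resolve_right hv0)
    obtain ⟨γ, hγ, hγz⟩ := hZ z hz
    refine ⟨γ, hγ, hγz.trans ?_⟩
    simp only [Polynomial.eval_sub, Polynomial.eval_X, Polynomial.eval_C, sub_eq_zero] at h3
    exact h3.symm
  cases L with
  | nil =>
    refine ⟨{1}, ?_, fun v _ => ?_⟩
    · intro z hz
      rw [Finset.mem_singleton] at hz
      refine ⟨(0, 0), isAddableTo_of_forall_le (fun a b _ h => by simp at h) (by simp)
        fun x hx => Or.inl (le_antisymm hx (Prod.le_def.2 ⟨Nat.zero_le _, Nat.zero_le _⟩)), ?_⟩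
      simp [nodeContent, hz]
    · subst hn
      simp [jm]
  | cons β L =>
    subst hn
    simp only [List.length_cons] at hlen ih ih' ⊢
    obtain ⟨Z, hZ, hann⟩ := ih L.length (Nat.lt_succ_self _) hL.2 (by omega) rfl
    set c := nodeContent q β with hc
    set g : Polynomial ℂ := ∏ z ∈ Z.erase c, (Polynomial.X - Polynomial.C z) with hg
    have hS := hL.2.isLowerSet
    set k := L.length with hk
    have hcm : Commute (jm s (k + 1)) (jm s k) := hs.commute_jm_jm (by omega) (by omega)
    have hpoly : ∀ (p : Polynomial ℂ) (v : R), HasWeights s ((β :: L).map (nodeContent q)) v →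
        HasWeights s ((β :: L).map (nodeContent q)) (Polynomial.aeval (jm s (k + 1)) p * v) := by
      intro p v hv
      refine hv.mul_left fun l hl => ?_
      simp only [List.length_map, List.length_cons] at hl
      exact aeval_mul_of_mul_eq (hs.commute_jm_jm (by omega) (by omega)).eq p
    -- The vector `s k * v` still has the weights of `L`, so the earlier annihilator applies to it.
    -- Since `J - c`, with `J = jm s k`, turns it into the intertwiner times `v`, moving `g` across
    -- and applying the intertwiner again gives a relation in `jm s (k + 1)` alone.
    have hquad : ∀ v : R, HasWeights s ((β :: L).map (nodeContent q)) v →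
        Polynomial.aeval (jm s (k + 1)) ((Polynomial.X - Polynomial.C (q ^ (2 : ℤ) * c)) *
          ((Polynomial.X - Polynomial.C (q ^ (-2 : ℤ) * c)) * g)) * v = 0 := by
      intro v hv
      have hv1 : jm s k * v = c • v := by
        have := hv.1
        rwa [List.length_map] at this
      have hu : HasWeights s (L.map (nodeContent q)) (s k * v) := by
        refine hv.2.mul_left fun l hl => ?_
        rw [List.length_map] at hl
        exact hs.commute_jm_gt hl (by omega)
      have h1 := hann _ hu
      have hdvd : (∏ z ∈ Z, (Polynomial.X - Polynomial.C z)) ∣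
          g * (Polynomial.X - Polynomial.C c) := by
        by_cases hcZ : c ∈ Z
        · rw [hg, Finset.prod_erase_mul _ _ hcZ]
        · rw [hg, Finset.erase_eq_of_notMem hcZ]
          exact dvd_mul_right _ _
      obtain ⟨e, he⟩ := hdvd
      have h2 : Polynomial.aeval (jm s k) (g * (Polynomial.X - Polynomial.C c)) * (s k * v) = 0 := by
        rw [he, mul_comm, map_mul, mul_assoc, h1, mul_zero]
      have h3 : Polynomial.aeval (jm s k) (Polynomial.X - Polynomial.C c) * (s k * v) =
          intertwiner q s k * v := by
        rw [map_sub, Polynomial.aeval_X, Polynomial.aeval_C, sub_mul, ← mul_assoc,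
          hs.jm_mul (by omega), ← Algebra.smul_def, intertwiner, sub_mul, sub_mul, mul_sub, sub_mul,
          mul_assoc (s k) (jm s k), hv1, mul_smul_comm]
        abel
      rw [map_mul, mul_assoc, h3, ← mul_assoc,
        aeval_mul_of_mul_eq (hs.jm_mul_intertwiner (by omega)), mul_assoc] at h2
      set w := Polynomial.aeval (jm s (k + 1)) g * v with hw
      have hw1 : jm s k * w = c • w := by
        have := (hpoly g v hv).1
        rwa [List.length_map] at this
      have h4 : intertwiner q s k * (intertwiner q s k * w) = 0 := by rw [h2, mul_zero]
      rw [← mul_assoc, hs.intertwiner_mul_self (by omega)] at h4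
      have h5 : Polynomial.aeval (jm s (k + 1)) ((Polynomial.X - Polynomial.C (q ^ (2 : ℤ) * c)) *
          (Polynomial.X - Polynomial.C (q ^ (-2 : ℤ) * c))) * w = 0 := by
        have h6 : ((Polynomial.X - Polynomial.C (q ^ (2 : ℤ) * c)) *
          (Polynomial.X - Polynomial.C (q ^ (-2 : ℤ) * c))) =
            Polynomial.X ^ 2 - Polynomial.C (2 * c + (q - q⁻¹) ^ 2 * c) * Polynomial.X +
              Polynomial.C (c ^ 2) := by
          have e1 : q ^ (2 : ℤ) * c + q ^ (-2 : ℤ) * c = 2 * c + (q - q⁻¹) ^ 2 * c := by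
            rw [zpow_neg, show q ^ (2 : ℤ) = q ^ 2 from rfl]
            field_simp
            ring
          have e2 : (q ^ (2 : ℤ) * c) * (q ^ (-2 : ℤ) * c) = c ^ 2 := by
            rw [zpow_neg, show q ^ (2 : ℤ) = q ^ 2 from rfl]
            field_simp
          rw [← e1, ← e2, Polynomial.C_add, Polynomial.C_mul (a := q ^ (2 : ℤ) * c)]
          ring
        rw [h6]
        have h7 : (jm s k * jm s (k + 1)) * w = c • (jm s (k + 1) * w) := by
          rw [← hcm.eq, mul_assoc, hw1, mul_smul_comm]
        have h8 : (jm s (k + 1) * jm s k) * w = c • (jm s (k + 1) * w) := by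
          rw [mul_assoc, hw1, mul_smul_comm]
        have h9 : (jm s k * jm s k) * w = c ^ 2 • w := by
          rw [mul_assoc, hw1, mul_smul_comm, hw1, smul_smul, pow_two]
        simp only [sub_mul, mul_sub, smul_mul_assoc, h7, h8, h9] at h4
        rw [map_add, map_sub, map_pow, map_mul, Polynomial.aeval_X, Polynomial.aeval_C,
          Polynomial.aeval_C, ← Algebra.smul_def, add_mul, sub_mul, smul_mul_assoc,
          ← Algebra.smul_def, pow_two (jm s (k + 1))]
        rw [← neg_eq_zero, ← h4]
        module
      rw [← mul_assoc, map_mul, mul_assoc]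
      exact h5
    have hβ := hL.1
    -- The roots `q^{±2} c` are new, so the product in `hquad` is a product over a finite set
    -- without repetition.
    have hZfar : ∀ e : ℤ, e = 1 ∨ e = -1 → q ^ (2 * e) * c ∉ Z.erase c := by
      intro e he hmem
      obtain ⟨γ, hγ, hγe⟩ := hZ _ (Finset.mem_of_mem_erase hmem)
      have h1 : diag γ = diag β + e := by
        rw [hc, nodeContent, nodeContent, ← zpow_add₀ hq0] at hγe
        have := zpow_inj_of_not_root hq0 hq hγe
        simp only [diag]
        omega
      have hne : γ ≠ β := by rintro rfl; omega
      have := hγ.diag_far hβ hne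
      omega
    have h1 : q ^ (2 : ℤ) * c ∉ Z.erase c := hZfar 1 (Or.inl rfl)
    have h2 : q ^ (-2 : ℤ) * c ∉ Z.erase c := hZfar (-1) (Or.inr rfl)
    have h3 : q ^ (2 : ℤ) * c ∉ insert (q ^ (-2 : ℤ) * c) (Z.erase c) := by
      rw [Finset.mem_insert, not_or]
      refine ⟨fun h => ?_, h1⟩
      have := zpow_inj_of_not_root hq0 hq (mul_right_cancel₀ (nodeContent_ne_zero hq0 β) h)
      omega
    set Y := insert (q ^ (2 : ℤ) * c) (insert (q ^ (-2 : ℤ) * c) (Z.erase c)) with hY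
    let good : ℂ → Prop := fun z =>
      ∃ γ, IsAddableTo {x | x ∈ β :: L} γ ∧ nodeContent q γ = z
    -- Only candidates that are contents of addable nodes are kept; the factors of the others are
    -- cancelled as having no eigenvectors.
    refine ⟨Y.filter good, fun z hz => (Finset.mem_filter.1 hz).2, fun v hv => ?_⟩
    refine eq_zero_of_prod_eq_zero (y := jm s (k + 1))
      (P := HasWeights s ((β :: L).map (nodeContent q)))
      (Y.filter fun z => ¬good z) (fun z u hu => hpoly _ u hu) ?_ (hpoly _ v hv) ?_
    · intro z hz u hu hyu
      obtain ⟨hzY, hbad⟩ := Finset.mem_filter.1 hz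
      -- A bad candidate `q^{±2} c` comes from a corner of `L` on that diagonal, so the weight would
      -- return to that of the corner.
      have hcase : ∀ e : ℤ, e = 1 ∨ e = -1 → z = q ^ (2 * e) * c →
          (∃ ρ ∈ {x | x ∈ L}, (∀ x ∈ {x | x ∈ L}, ρ ≤ x → x = ρ) ∧ diag ρ = diag β + e) →
          u = 0 := by
        rintro e he hze ⟨ρ, hρ, hmax, hd⟩
        refine hs.eq_zero_of_corner_return hq0 hq hL.2 hβ hρ hmax (by omega) (by omega)
          (fun L' hL' hl => ih' L' hL' (by omega)) ⟨?_, hu⟩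
        rw [List.length_cons, List.length_map, hyu, hze, nodeContent_of_diag_eq_add hq0 hd]
      have hnot : ∀ e : ℤ, z = q ^ (2 * e) * c →
          ¬∃ γ, IsAddableTo (insert β {x | x ∈ L}) γ ∧ diag γ = diag β + e := by
        rintro e hze ⟨γ, hγ, hd⟩
        refine hbad ⟨γ, by rwa [setOf_mem_cons], ?_⟩
        rw [hze, nodeContent_of_diag_eq_add hq0 hd]
      rw [hY, Finset.mem_insert, Finset.mem_insert] at hzY
      rcases hzY with hz1 | hz1 | hz1
      · exact hcase 1 (Or.inl rfl) hz1 (exists_corner_right hβ hS (hnot 1 hz1))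
      · exact hcase (-1) (Or.inr rfl) hz1 (exists_corner_below hβ hS (hnot (-1) hz1))
      · obtain ⟨γ, hγ, hγz⟩ := hZ z (Finset.mem_of_mem_erase hz1)
        refine absurd ⟨γ, ?_, hγz⟩ hbad
        rw [setOf_mem_cons]
        refine hβ.insert hγ ?_
        rintro rfl
        exact Finset.ne_of_mem_erase hz1 hγz.symm
    · have h4 := hquad v hv
      rw [hg, ← Finset.prod_insert (f := fun z => Polynomial.X - Polynomial.C z) h2,
        ← Finset.prod_insert (f := fun z => Polynomial.X - Polynomial.C z) h3] at h4
      rw [← mul_assoc, ← map_mul, mul_comm, Finset.prod_filter_mul_prod_filter_not]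
      exact h4

end

/-! ### The generators of the Hecke algebra -/

variable {n : ℕ} {q : ℂ}

/-- The inverse `σ_i - λ` of `σ_i`. -/
noncomputable def sigmaInv (n : ℕ) (q : ℂ) (i : ℕ) : HeckeAlgebra n q :=
  sigma n q i - (q - q⁻¹) • 1

theorem sigma_mul_sigmaInv (hq0 : q ≠ 0) {i : ℕ} (h1 : 1 ≤ i) (hn : i < n) :
    sigma n q i * sigmaInv n q i = 1 := by
  rw [sigmaInv, ← Algebra.algebraMap_eq_smul_one]
  exact sigma_mul_inverse n q hq0 h1 hn

theorem sigma_mul_self (hq0 : q ≠ 0) {i : ℕ} (h1 : 1 ≤ i) (hn : i < n) :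
    sigma n q i * sigma n q i = 1 + (q - q⁻¹) • sigma n q i := by
  have h := sigma_mul_sigmaInv hq0 h1 hn
  rw [sigmaInv, mul_sub, mul_smul_comm, mul_one, sub_eq_iff_eq_add] at h
  exact h

theorem sigma_braid {i : ℕ} (h1 : 1 ≤ i) (hn : i + 1 < n) :
    sigma n q i * sigma n q (i + 1) * sigma n q i =
      sigma n q (i + 1) * sigma n q i * sigma n q (i + 1) := by
  have h := RingQuot.mkAlgHom_rel ℂ (HeckeRel.braid (n := n) (q := q) ⟨i - 1, by omega⟩
    ⟨i, by omega⟩ (by simp only; omega))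
  simp only [map_mul] at h
  simpa [sigma, h1, hn, show i < n by omega] using h

theorem sigma_commute {i k : ℕ} (h : i + 1 < k ∨ k + 1 < i) :
    Commute (sigma n q i) (sigma n q k) := by
  wlog hik : i < k generalizing i k
  · exact (this h.symm (by omega)).symm
  by_cases hi : 1 ≤ i ∧ i < n
  · by_cases hk : 1 ≤ k ∧ k < n
    · have h := RingQuot.mkAlgHom_rel ℂ (HeckeRel.comm (n := n) (q := q) ⟨i - 1, by omega⟩
        ⟨k - 1, by omega⟩ (by simp only; omega))
      simp only [map_mul] at h
      rw [sigma, sigma, dif_pos hi, dif_pos hk]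
      exact h
    · rw [sigma.eq_1 n q k, dif_neg hk]
      exact Commute.one_right _
  · rw [sigma, dif_neg hi]
    exact Commute.one_left _

theorem commute_sigmaInv {h : HeckeAlgebra n q} {i : ℕ} (hc : Commute h (sigma n q i)) :
    Commute h (sigmaInv n q i) :=
  hc.sub_right ((Commute.one_right h).smul_right _)

theorem sigmaInv_braid (hq0 : q ≠ 0) {i : ℕ} (h1 : 1 ≤ i) (hn : i + 1 < n) :
    sigmaInv n q (i + 1) * sigmaInv n q i * sigma n q (i + 1) =
      sigma n q i * sigmaInv n q (i + 1) * sigmaInv n q i := by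
  have hb := sigma_braid (q := q) h1 hn
  have e1 := sigma_mul_self hq0 h1 (show i < n by omega)
  have e2 := sigma_mul_self hq0 (i := i + 1) (by omega) hn
  simp only [sigmaInv, sub_mul, mul_sub, smul_mul_assoc, mul_smul_comm, one_mul, mul_one, hb, e1,
    e2]
  module

theorem isHecke_sigma (hq0 : q ≠ 0) {j : ℕ} (hj : 1 ≤ j) :
    IsHecke q (n - j) fun i => sigma n q (j + i) where
  quad i hi := sigma_mul_self hq0 (by omega) (by omega)
  braid i hi := sigma_braid (by omega) (by omega)
  comm i k hik _ := sigma_commute (Or.inl (by omega))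

theorem jucysMurphy_eq_jm (j k : ℕ) :
    jucysMurphy n q j k = jm (fun i => sigma n q (j + i)) k := by
  induction k with
  | zero => rfl
  | succ k ih => simp only [jucysMurphy, jm, ih]

/-! ### Standard tableaux as growing lists of nodes -/

namespace StandardTableau

/-- The nodes of a standard tableau, the last one first. -/
def nodeList : {m : ℕ} → StandardTableau m → List (ℕ × ℕ)
  | 0, _ => []
  | m + 1, T => T.node (Fin.last m) :: T.init.nodeList

theorem length_nodeList {m : ℕ} (T : StandardTableau m) : T.nodeList.length = m := by
  induction m with
  | zero => rfl
  | succ m ih => simp [nodeList, ih]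

theorem node_last_mem {m : ℕ} (T : StandardTableau (m + 1)) :
    T.node (Fin.last m) ∈ T.shape.cells :=
  (T.mem_shape_iff _).2 ⟨_, rfl⟩

theorem mem_nodeList {m : ℕ} (T : StandardTableau m) (α : ℕ × ℕ) :
    α ∈ T.nodeList ↔ α ∈ T.shape.cells := by
  induction m with
  | zero =>
    rw [T.mem_shape_iff]
    simp [nodeList]
  | succ m ih =>
    rw [nodeList, List.mem_cons, ih]
    simp only [init, Finset.mem_erase]
    by_cases h : α = T.node (Fin.last m)
    · simp [h, T.node_last_mem]
    · simp [h]

theorem setOf_mem_nodeList {m : ℕ} (T : StandardTableau m) :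
    {x | x ∈ T.nodeList} = (T.shape.cells : Set (ℕ × ℕ)) :=
  Set.ext T.mem_nodeList

theorem isAddable_node_last {m : ℕ} (T : StandardTableau (m + 1)) :
    IsAddable T.init.shape (T.node (Fin.last m)) := by
  refine ⟨by simp [init], ?_⟩
  simp only [init, Finset.insert_erase T.node_last_mem]
  exact T.shape.isLowerSet

theorem isGrowth_nodeList {m : ℕ} (T : StandardTableau m) : IsGrowth T.nodeList := by
  induction m with
  | zero => trivial
  | succ m ih =>
    refine ⟨?_, ih T.init⟩
    have h := T.isAddable_node_last
    rw [IsAddable, Finset.coe_insert] at h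
    rw [setOf_mem_nodeList]
    exact h

end StandardTableau

theorem isAddable_iff_isAddableTo (μ : YoungDiagram) (β : ℕ × ℕ) :
    IsAddable μ β ↔ IsAddableTo (μ.cells : Set (ℕ × ℕ)) β := by
  rw [IsAddable, IsAddableTo, Finset.coe_insert, Finset.mem_coe]

/-! ### Properties of the idempotents -/

/-- The polynomial in the last Jucys-Murphy element in the recursion for the idempotents. -/
noncomputable def idempotentPoly (q : ℂ) {m : ℕ} (T : StandardTableau (m + 1)) : Polynomial ℂ :=
  ∏ β ∈ (addableNodes T.init.shape).erase (T.node (Fin.last m)),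
    Polynomial.C (content q T (Fin.last m) - nodeContent q β)⁻¹ *
      (Polynomial.X - Polynomial.C (nodeContent q β))

theorem idempotent_succ {m : ℕ} (j : ℕ) (T : StandardTableau (m + 1)) :
    idempotent n q j T =
      idempotent n q j T.init * Polynomial.aeval (jucysMurphy n q j m) (idempotentPoly q T) :=
  rfl

theorem eq_of_isAddable_of_content_eq (hq0 : q ≠ 0) (hq : ∀ k : ℕ, 0 < k → q ^ k ≠ 1)
    {μ : YoungDiagram} {β γ : ℕ × ℕ} (hβ : IsAddable μ β) (hγ : IsAddable μ γ)
    (h : nodeContent q β = nodeContent q γ) : β = γ := by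
  rw [isAddable_iff_isAddableTo] at hβ hγ
  by_contra hne
  have h1 := hβ.diag_far hγ hne
  have h2 := diag_eq_of_nodeContent_eq hq0 hq h
  omega

theorem content_sub_ne_zero (hq0 : q ≠ 0) (hq : ∀ k : ℕ, 0 < k → q ^ k ≠ 1) {m : ℕ}
    (T : StandardTableau (m + 1)) {β : ℕ × ℕ}
    (hβ : β ∈ (addableNodes T.init.shape).erase (T.node (Fin.last m))) :
    content q T (Fin.last m) - nodeContent q β ≠ 0 := by
  rw [Finset.mem_erase, mem_addableNodes] at hβ
  intro h
  exact hβ.1 (eq_of_isAddable_of_content_eq hq0 hq hβ.2 T.isAddable_node_last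
    (sub_eq_zero.1 h).symm)

theorem eval_idempotentPoly (hq0 : q ≠ 0) (hq : ∀ k : ℕ, 0 < k → q ^ k ≠ 1) {m : ℕ}
    (T : StandardTableau (m + 1)) :
    (idempotentPoly q T).eval (content q T (Fin.last m)) = 1 := by
  rw [idempotentPoly, Polynomial.eval_prod]
  refine Finset.prod_eq_one fun β hβ => ?_
  have h := content_sub_ne_zero hq0 hq T hβ
  simp only [Polynomial.eval_mul, Polynomial.eval_C, Polynomial.eval_sub, Polynomial.eval_X]
  exact inv_mul_cancel₀ h

/-- The idempotent polynomial omits just the root `c_m`, so restoring that factor makes it a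
multiple of every annihilator supported on addable contents. -/
theorem prod_dvd_idempotentPoly {m : ℕ}
    (T : StandardTableau (m + 1)) (Z : Finset ℂ)
    (hZ : ∀ z ∈ Z, ∃ γ, IsAddableTo {x | x ∈ T.init.nodeList} γ ∧ nodeContent q γ = z) :
    (∏ z ∈ Z, (Polynomial.X - Polynomial.C z)) ∣
      (Polynomial.X - Polynomial.C (content q T (Fin.last m))) * idempotentPoly q T := by
  refine Finset.prod_dvd_of_coprime
    (fun a _ b _ hab => Polynomial.pairwise_coprime_X_sub_C Function.injective_id hab) ?_
  intro z hz
  obtain ⟨γ, hγ, rfl⟩ := hZ z hz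
  rw [T.init.setOf_mem_nodeList, ← isAddable_iff_isAddableTo] at hγ
  by_cases h : γ = T.node (Fin.last m)
  · subst h
    exact dvd_mul_right _ _
  · have hm : γ ∈ (addableNodes T.init.shape).erase (T.node (Fin.last m)) :=
      Finset.mem_erase.2 ⟨h, (mem_addableNodes _ _).2 hγ⟩
    exact ((dvd_mul_left _ _).trans (Finset.dvd_prod_of_mem (fun β =>
      Polynomial.C (content q T (Fin.last m) - nodeContent q β)⁻¹ *
        (Polynomial.X - Polynomial.C (nodeContent q β))) hm)).trans (dvd_mul_left _ _)

/-- The idempotents are products of polynomials in the Jucys–Murphy elements, so intertwining those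
elements suffices. -/
theorem idempotent_intertwine {j j' m : ℕ} (T : StandardTableau m) {d : HeckeAlgebra n q}
    (hd : ∀ k < m, d * jucysMurphy n q j' k = jucysMurphy n q j k * d) :
    d * idempotent n q j' T = idempotent n q j T * d := by
  induction m with
  | zero => simp [idempotent]
  | succ m ih =>
    have h1 := ih T.init fun k hk => hd k (by omega)
    rw [idempotent_succ, idempotent_succ, ← mul_assoc, h1, mul_assoc,
      ← aeval_mul_of_mul_eq (hd m (by omega)).symm, mul_assoc]

theorem commute_idempotent {j m : ℕ} (T : StandardTableau m) {h : HeckeAlgebra n q}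
    (hc : ∀ i, i + 1 < m → Commute h (sigma n q (j + i))) : Commute h (idempotent n q j T) := by
  refine idempotent_intertwine T fun k hk => ?_
  rw [jucysMurphy_eq_jm]
  exact commute_jm_of_forall fun i hi => hc i (by omega)

theorem commute_jucysMurphy_idempotent (hq0 : q ≠ 0) {j m k : ℕ} (hj : 1 ≤ j)
    (hm : j + m ≤ n + 1) (hk : j + k ≤ n) (T : StandardTableau m) :
    Commute (jucysMurphy n q j k) (idempotent n q j T) := by
  refine idempotent_intertwine T fun l hl => ?_
  rw [jucysMurphy_eq_jm, jucysMurphy_eq_jm]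
  exact (isHecke_sigma hq0 hj).commute_jm_jm (by omega) (by omega)

/-- The Jucys-Murphy elements act on the idempotent by the contents of the tableau. -/
theorem hasWeights_idempotent (hq0 : q ≠ 0) (hq : ∀ k : ℕ, 0 < k → q ^ k ≠ 1) {j m : ℕ}
    (hj : 1 ≤ j) (hm : j + m ≤ n + 1) (T : StandardTableau m) :
    HasWeights (fun i => sigma n q (j + i)) (T.nodeList.map (nodeContent q))
      (idempotent n q j T) := by
  induction m with
  | zero => trivial
  | succ m ih =>
    have hw := ih (by omega) T.init
    refine ⟨?_, hw.mul_right _⟩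
    rw [List.length_map, T.init.length_nodeList]
    obtain ⟨Z, hZ, hann⟩ := (isHecke_sigma hq0 hj (n := n)).exists_annihilator hq0 hq
      T.init.isGrowth_nodeList (by rw [T.init.length_nodeList]; omega)
    have h1 := hann _ hw
    rw [T.init.length_nodeList, ← jucysMurphy_eq_jm] at h1
    rw [← jucysMurphy_eq_jm]
    obtain ⟨e, he⟩ := prod_dvd_idempotentPoly T Z hZ
    have hc : Commute (idempotent n q j T.init) (jucysMurphy n q j m) :=
      (commute_jucysMurphy_idempotent hq0 hj (by omega) (by omega) T.init).symm
    -- This is `(J - c_m) A = 0` for `J = J_{m+1,j}` and the new idempotent, with `c_m` short for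
    -- the content of its last node.
    have h2 : Polynomial.aeval (jucysMurphy n q j m)
        ((Polynomial.X - Polynomial.C (content q T (Fin.last m))) * idempotentPoly q T) *
          idempotent n q j T.init = 0 := by
      rw [he, mul_comm, map_mul, mul_assoc, h1, mul_zero]
    rw [map_mul, mul_assoc, aeval_mul_of_mul_eq hc.eq.symm, map_sub, Polynomial.aeval_X,
      Polynomial.aeval_C, sub_mul, sub_eq_zero, ← Algebra.smul_def] at h2
    exact h2

theorem jucysMurphy_mul_idempotent (hq0 : q ≠ 0) (hq : ∀ k : ℕ, 0 < k → q ^ k ≠ 1) {j m : ℕ}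
    (hj : 1 ≤ j) (hm : j + m ≤ n) (T : StandardTableau (m + 1)) :
    jucysMurphy n q j m * idempotent n q j T = content q T (Fin.last m) • idempotent n q j T := by
  have h := (hasWeights_idempotent (n := n) hq0 hq hj (by omega) T).1
  rwa [List.length_map, T.init.length_nodeList, ← jucysMurphy_eq_jm] at h

/-- Each polynomial factor is normalized to take the value one at the content of its node. Together
with `hasWeights_idempotent` this makes the elements idempotent. -/
theorem idempotent_mul_of_hasWeights (hq0 : q ≠ 0) (hq : ∀ k : ℕ, 0 < k → q ^ k ≠ 1) {j m : ℕ}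
    (T : StandardTableau m) {v : HeckeAlgebra n q}
    (hv : HasWeights (fun i => sigma n q (j + i)) (T.nodeList.map (nodeContent q)) v) :
    idempotent n q j T * v = v := by
  induction m with
  | zero => simp [idempotent]
  | succ m ih =>
    have h1 := hv.1
    rw [List.length_map, T.init.length_nodeList, ← jucysMurphy_eq_jm] at h1
    rw [idempotent_succ, mul_assoc, aeval_mul_of_eigen h1]
    have h2 := eval_idempotentPoly hq0 hq T
    rw [content] at h2
    rw [h2, one_smul, ih T.init hv.2]

theorem idempotent_mul_self (hq0 : q ≠ 0) (hq : ∀ k : ℕ, 0 < k → q ^ k ≠ 1) {j m : ℕ}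
    (hj : 1 ≤ j) (hm : j + m ≤ n + 1) (T : StandardTableau m) :
    idempotent n q j T * idempotent n q j T = idempotent n q j T :=
  idempotent_mul_of_hasWeights hq0 hq T (hasWeights_idempotent hq0 hq hj hm T)

theorem idempotent_mul_init (hq0 : q ≠ 0) (hq : ∀ k : ℕ, 0 < k → q ^ k ≠ 1) {j m : ℕ}
    (hj : 1 ≤ j) (hm : j + m ≤ n) (T : StandardTableau (m + 1)) :
    idempotent n q j T * idempotent n q j T.init = idempotent n q j T := by
  have hc := commute_jucysMurphy_idempotent hq0 hj (k := m) (by omega) hm T.init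
  rw [idempotent_succ, mul_assoc, aeval_mul_of_mul_eq hc.eq, ← mul_assoc,
    idempotent_mul_self hq0 hq hj (by omega)]

/-! ### Unprojected descending and ascending products -/

/-- The product `σ_{j+m-1} ⋯ σ_j`. -/
noncomputable def sigmaDesc (n : ℕ) (q : ℂ) (j m : ℕ) : HeckeAlgebra n q :=
  descProd (fun i => sigma n q (j + i)) m

/-- The product `σ_{j+m-1}⁻¹ ⋯ σ_j⁻¹`. -/
noncomputable def sigmaInvDesc (n : ℕ) (q : ℂ) (j m : ℕ) : HeckeAlgebra n q :=
  descProd (fun i => sigmaInv n q (j + i)) m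

theorem sigmaDesc_succ (j m : ℕ) :
    sigmaDesc n q j (m + 1) = sigma n q (j + m) * sigmaDesc n q j m := rfl

theorem sigmaInvDesc_succ (j m : ℕ) :
    sigmaInvDesc n q j (m + 1) = sigmaInv n q (j + m) * sigmaInvDesc n q j m := rfl

theorem sigmaDesc_mul_idempotent {j m : ℕ} (hj : 1 ≤ j) (hm : j + m ≤ n)
    (T : StandardTableau m) :
    sigmaDesc n q j m * idempotent n q (j + 1) T = idempotent n q j T * sigmaDesc n q j m := by
  refine idempotent_intertwine T fun k hk => ?_
  rw [jucysMurphy_eq_jm, jucysMurphy_eq_jm]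
  refine mul_jm_of_forall fun i hi => ?_
  rw [show j + 1 + i = j + (i + 1) by omega]
  refine descProd_mul_shift (s := fun i => sigma n q (j + i)) (r := fun i => sigma n q (j + i))
    ?_ ?_ ?_ (by omega)
  · exact fun i l h1 _ => sigma_commute (Or.inr (by omega))
  · exact fun i l h1 _ => sigma_commute (Or.inr (by omega))
  · exact fun i h1 => (sigma_braid (n := n) (q := q) (i := j + i) (by omega) (by omega)).symm

theorem sigmaInvDesc_mul_idempotent (hq0 : q ≠ 0) {j m : ℕ} (hj : 1 ≤ j) (hm : j + m ≤ n)
    (T : StandardTableau m) :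
    sigmaInvDesc n q j m * idempotent n q (j + 1) T =
      idempotent n q j T * sigmaInvDesc n q j m := by
  refine idempotent_intertwine T fun k hk => ?_
  rw [jucysMurphy_eq_jm, jucysMurphy_eq_jm]
  refine mul_jm_of_forall fun i hi => ?_
  rw [show j + 1 + i = j + (i + 1) by omega]
  refine descProd_mul_shift (s := fun i => sigma n q (j + i)) (r := fun i => sigmaInv n q (j + i))
    ?_ ?_ ?_ (by omega)
  · exact fun i l h1 _ => (commute_sigmaInv (sigma_commute (Or.inl (by omega)))).symm
  · exact fun i l h1 _ => commute_sigmaInv (sigma_commute (Or.inr (by omega)))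
  · exact fun i h1 => sigmaInv_braid (n := n) hq0 (i := j + i) (by omega) (by omega)

/-- The Jucys–Murphy element is the descending product times the ascending one, and the latter
cancels against the inverses. -/
theorem sigmaDesc_eq (hq0 : q ≠ 0) {j m : ℕ} (hj : 1 ≤ j) (hm : j + m ≤ n) :
    sigmaDesc n q j m = jucysMurphy n q j m * sigmaInvDesc n q j m := by
  induction m with
  | zero => simp [sigmaDesc, sigmaInvDesc, descProd, jucysMurphy]
  | succ m ih =>
    have h := sigma_mul_sigmaInv hq0 (i := j + m) (by omega) (show j + m < n by omega)
    rw [sigmaDesc_succ, sigmaInvDesc_succ, ih (by omega), jucysMurphy, mul_assoc _ (sigma n q _),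
      ← mul_assoc (sigma n q _) (sigmaInv n q _), h, one_mul, mul_assoc]

theorem exists_mul_sigmaInvDesc_eq_one (hq0 : q ≠ 0) {j m : ℕ} (hj : 1 ≤ j) (hm : j + m ≤ n) :
    ∃ b : HeckeAlgebra n q, b * sigmaInvDesc n q j m = 1 := by
  induction m with
  | zero => exact ⟨1, by simp [sigmaInvDesc, descProd]⟩
  | succ m ih =>
    obtain ⟨b, hb⟩ := ih (by omega)
    refine ⟨b * sigma n q (j + m), ?_⟩
    rw [sigmaInvDesc_succ, mul_assoc, ← mul_assoc (sigma n q _),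
      sigma_mul_sigmaInv hq0 (by omega) (by omega), one_mul, hb]

/-! ### Factorization of the projected descending product, over `ℂ` or over polynomials -/

section Scalars

variable {K A : Type*} [CommRing K] [Ring A] [Algebra K A]
  (f : HeckeAlgebra n q →+* A) (κ : ℂ →+* K) (a b : K) (j : ℕ)

/-- The descending product of the factors `a c_i σ_{j+i-1} - b σ_{j+i-1}⁻¹`. -/
noncomputable def fusedDesc : {m : ℕ} → StandardTableau m → A
  | 0, _ => 1
  | m + 1, T =>
      ((a * κ (content q T (Fin.last m))) • f (sigma n q (j + m)) -
        b • f (sigmaInv n q (j + m))) * fusedDesc T.init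

/-- The ascending product of the factors `b σ_{j+i-1} - a c_i σ_{j+i-1}⁻¹`. -/
noncomputable def fusedAsc : {m : ℕ} → StandardTableau m → A
  | 0, _ => 1
  | m + 1, T =>
      fusedAsc T.init * (b • f (sigma n q (j + m)) -
        (a * κ (content q T (Fin.last m))) • f (sigmaInv n q (j + m)))

/-- The product of the scalars `a c_i - b`. -/
noncomputable def fusedScalar (q : ℂ) (κ : ℂ →+* K) (a b : K) :
    {m : ℕ} → StandardTableau m → K
  | 0, _ => 1
  | m + 1, T => (a * κ (content q T (Fin.last m)) - b) * fusedScalar q κ a b T.init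

variable {f κ a b j}

theorem map_sigmaInv (hf : ∀ c h, f (c • h) = κ c • f h) (i : ℕ) :
    f (sigmaInv n q i) = f (sigma n q i) - κ (q - q⁻¹) • 1 := by
  rw [sigmaInv, map_sub, hf, map_one]

/-- The spectral shifts by contents are chosen so that the cross terms of the expansion vanish: they
are multiples of `D - c D'`, while `D = J D'` and `J` acts on the idempotent by `c`. -/
theorem idempotent_mul_fusedDesc (hq0 : q ≠ 0) (hq : ∀ k : ℕ, 0 < k → q ^ k ≠ 1)
    (hf : ∀ c h, f (c • h) = κ c • f h) {m : ℕ} (hj : 1 ≤ j) (hm : j + m ≤ n)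
    (T : StandardTableau m) :
    (a - b) • (f (idempotent n q j T) * fusedDesc f κ a b j T) =
      fusedScalar q κ a b T • (f (idempotent n q j T) *
        (a • f (sigmaDesc n q j m) - b • f (sigmaInvDesc n q j m))) := by
  induction m with
  | zero =>
    simp [idempotent, fusedDesc, fusedScalar, sigmaDesc, sigmaInvDesc, descProd, sub_smul]
  | succ m ih =>
    have h1 := ih (by omega) T.init
    set c := κ (content q T (Fin.last m)) with hc
    set P := f (idempotent n q j T) with hP
    set Q := f (idempotent n q j T.init) with hQ
    set S := f (sigma n q (j + m)) with hS
    set S' := f (sigmaInv n q (j + m)) with hS'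
    set D := f (sigmaDesc n q j m) with hD
    set D' := f (sigmaInvDesc n q j m) with hD'
    have hPQ : P * Q = P := by
      rw [hP, hQ, ← map_mul, idempotent_mul_init hq0 hq hj (by omega)]
    have hcomm : Commute Q S := by
      have : Commute (sigma n q (j + m)) (idempotent n q j T.init) :=
        commute_idempotent T.init fun i hi => sigma_commute (Or.inr (by omega))
      exact (this.map f).symm
    have hcomm' : Commute Q S' := by
      rw [hS', map_sigmaInv hf]
      exact hcomm.sub_right ((Commute.one_right Q).smul_right _)
    have hPD : P * D = c • (P * D') := by
      rw [hP, hD, hD', ← map_mul, ← map_mul, sigmaDesc_eq hq0 hj (by omega), ← mul_assoc,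
        ← (commute_jucysMurphy_idempotent hq0 hj (by omega) (by omega) T).eq,
        jucysMurphy_mul_idempotent hq0 hq hj (by omega), smul_mul_assoc, hf]
    have hSS : S' = S - κ (q - q⁻¹) • 1 := map_sigmaInv hf _
    have hF : fusedDesc f κ a b j T = ((a * c) • S - b • S') * fusedDesc f κ a b j T.init := rfl
    have hX : Commute Q ((a * c) • S - b • S') :=
      (hcomm.smul_right _).sub_right (hcomm'.smul_right _)
    calc (a - b) • (P * fusedDesc f κ a b j T)
        = (a - b) • (P * Q * (((a * c) • S - b • S') * fusedDesc f κ a b j T.init)) := by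
          rw [hF, hPQ]
      _ = P * ((a * c) • S - b • S') * ((a - b) • (Q * fusedDesc f κ a b j T.init)) := by
          rw [mul_assoc P Q, ← mul_assoc Q, hX.eq, mul_smul_comm]
          simp only [mul_assoc]
      _ = fusedScalar q κ a b T.init •
            (P * Q * (((a * c) • S - b • S') * (a • D - b • D'))) := by
          rw [h1, mul_smul_comm, ← mul_assoc, mul_assoc P _ Q, ← hX.eq]
          simp only [mul_assoc]
      _ = fusedScalar q κ a b T.init • ((a * c - b) •
            (P * (a • (S * D) - b • (S' * D')))) := by
          rw [hPQ]
          congr 1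
          -- The remainder `D - c • D'` is what `P` kills by `hPD`.
          have e : ((a * c) • S - b • S') * (a • D - b • D') =
              (a * c - b) • (a • (S * D) - b • (S' * D')) +
                (a * b * κ (q - q⁻¹)) • (D - c • D') := by
            rw [hSS]
            simp only [sub_mul, mul_sub, smul_mul_assoc, mul_smul_comm, one_mul]
            module
          rw [e, mul_add, mul_smul_comm, mul_smul_comm, mul_sub P D, mul_smul_comm, hPD, sub_self,
            smul_zero, add_zero]
      _ = _ := by
          rw [smul_smul, sigmaDesc_succ, sigmaInvDesc_succ, map_mul, map_mul, fusedScalar,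
            mul_comm (fusedScalar q κ a b T.init)]

theorem intertwine_idempotent_map (hq0 : q ≠ 0) {m : ℕ} (hj : 1 ≤ j) (hm : j + m ≤ n)
    (T : StandardTableau m) :
    f (idempotent n q j T) * (a • f (sigmaDesc n q j m) - b • f (sigmaInvDesc n q j m)) =
      (a • f (sigmaDesc n q j m) - b • f (sigmaInvDesc n q j m)) *
        f (idempotent n q (j + 1) T) := by
  rw [mul_sub, sub_mul, mul_smul_comm, mul_smul_comm, smul_mul_assoc, smul_mul_assoc, ← map_mul,
    ← map_mul, ← map_mul, ← map_mul, sigmaDesc_mul_idempotent hj hm,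
    sigmaInvDesc_mul_idempotent hq0 hj hm]

/-- Unitarity: factors cancel in pairs from the inside, as `σ² + σ⁻²` is the scalar `2 + λ²`. -/
theorem exists_fusedDesc_mul_fusedAsc (hq0 : q ≠ 0) (hf : ∀ c h, f (c • h) = κ c • f h) {m : ℕ}
    (hj : 1 ≤ j) (hm : j + m ≤ n) (T : StandardTableau m) :
    ∃ t : K, fusedDesc f κ a b j T * fusedAsc f κ a b j T = t • 1 := by
  induction m with
  | zero => exact ⟨1, by simp [fusedDesc, fusedAsc]⟩
  | succ m ih =>
    obtain ⟨t, ht⟩ := ih (by omega) T.init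
    set c := κ (content q T (Fin.last m)) with hc
    set S := f (sigma n q (j + m)) with hS
    have hSS : S * S = 1 + κ (q - q⁻¹) • S := by
      rw [hS, ← map_mul, sigma_mul_self hq0 (by omega) (by omega), map_add, map_one, hf]
    refine ⟨t * (a * b * c * (2 + κ (q - q⁻¹) ^ 2) - a ^ 2 * c ^ 2 - b ^ 2), ?_⟩
    rw [fusedDesc, fusedAsc, mul_assoc, ← mul_assoc (fusedDesc f κ a b j T.init), ht,
      smul_mul_assoc, one_mul, mul_smul_comm, mul_smul t, map_sigmaInv hf]
    congr 1
    rw [← hS, ← hc]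
    simp only [sub_mul, mul_sub, smul_mul_assoc, mul_smul_comm, one_mul, mul_one, hSS]
    module

/-- Multiply the factorization on the right by the ascending product and `A_j - 1`. By unitarity the
left side becomes a multiple of `A_j (A_j - 1) = 0`. -/
theorem smul_mul_fusedAsc_eq_zero (hq0 : q ≠ 0) (hq : ∀ k : ℕ, 0 < k → q ^ k ≠ 1)
    (hf : ∀ c h, f (c • h) = κ c • f h) {m : ℕ} (hj : 1 ≤ j) (hm : j + m ≤ n)
    (T : StandardTableau m) :
    fusedScalar q κ a b T • ((a • f (sigmaDesc n q j m) - b • f (sigmaInvDesc n q j m)) *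
      (f (idempotent n q (j + 1) T) * fusedAsc f κ a b j T *
        (f (idempotent n q j T) - 1))) = 0 := by
  have h1 := congrArg (· * (fusedAsc f κ a b j T * (f (idempotent n q j T) - 1)))
    (idempotent_mul_fusedDesc (a := a) (b := b) hq0 hq hf hj hm T)
  obtain ⟨t, ht⟩ := exists_fusedDesc_mul_fusedAsc (a := a) (b := b) hq0 hf hj hm T
  have h2 : f (idempotent n q j T) * (f (idempotent n q j T) - 1) = 0 := by
    rw [mul_sub, ← map_mul, idempotent_mul_self hq0 hq hj (by omega), mul_one, sub_self]
  simp only [intertwine_idempotent_map hq0 hj hm] at h1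
  rw [smul_mul_assoc, mul_assoc, ← mul_assoc (fusedDesc f κ a b j T), ht, smul_mul_assoc, one_mul,
    mul_smul_comm, h2, smul_zero, smul_zero, smul_mul_assoc] at h1
  rw [h1]
  simp only [mul_assoc]

end Scalars

/-! ### Baxterized elements -/

theorem baxter_eq (i : ℕ) (x : ℂ) :
    baxter n q i x = sigma n q i + ((q - q⁻¹) * x / (1 - x)) • 1 := by
  rw [baxter, Algebra.algebraMap_eq_smul_one]

theorem smul_baxter {x : ℂ} (hx : x ≠ 1) (i : ℕ) :
    (1 - x) • baxter n q i x = sigma n q i - x • sigmaInv n q i := by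
  have h : 1 - x ≠ 0 := sub_ne_zero.2 hx.symm
  rw [baxter_eq, smul_add, smul_smul, mul_div_cancel₀ _ h, sigmaInv]
  module

theorem commute_baxter {h : HeckeAlgebra n q} {i : ℕ} (hc : Commute h (sigma n q i)) (x : ℂ) :
    Commute h (baxter n q i x) := by
  rw [baxter_eq]
  exact hc.add_right ((Commute.one_right h).smul_right _)

/-- The Yang-Baxter equation. -/
theorem baxter_yang_baxter (hq0 : q ≠ 0) {i : ℕ} (h1 : 1 ≤ i) (hn : i + 1 < n) {x y z : ℂ}
    (hy : y = x * z) (hx1 : x ≠ 1) (hy1 : y ≠ 1) (hz1 : z ≠ 1) :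
    baxter n q i x * baxter n q (i + 1) y * baxter n q i z =
      baxter n q (i + 1) z * baxter n q i y * baxter n q (i + 1) x := by
  have ex : 1 - x ≠ 0 := sub_ne_zero.2 hx1.symm
  have ey : 1 - y ≠ 0 := sub_ne_zero.2 hy1.symm
  have ez : 1 - z ≠ 0 := sub_ne_zero.2 hz1.symm
  have hb := sigma_braid (q := q) h1 hn
  have e1 := sigma_mul_self hq0 h1 (show i < n by omega)
  have e2 := sigma_mul_self hq0 (i := i + 1) (by omega) hn
  simp only [baxter_eq]
  generalize ht : q - q⁻¹ = t at *
  have key : (t * y / (1 - y)) * (t + t * x / (1 - x) + t * z / (1 - z)) -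
      (t * x / (1 - x)) * (t * z / (1 - z)) = 0 := by
    subst hy
    field_simp
    ring
  generalize t * x / (1 - x) = a at *
  generalize t * y / (1 - y) = c at *
  generalize t * z / (1 - z) = b at *
  -- The braid and quadratic relations leave only a multiple of `σ_i - σ_{i+1}`, whose coefficient
  -- is zero by `key`.
  have e : (sigma n q i + a • 1) * (sigma n q (i + 1) + c • 1) * (sigma n q i + b • 1) -
      (sigma n q (i + 1) + b • 1) * (sigma n q i + c • 1) * (sigma n q (i + 1) + a • 1) =
        (c * (t + a + b) - a * b) • (sigma n q i - sigma n q (i + 1)) := by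
    simp only [add_mul, mul_add, smul_mul_assoc, mul_smul_comm, one_mul, mul_one, hb, e1, e2]
    module
  rw [key, zero_smul, sub_eq_zero] at e
  exact e

theorem baxterRight_succ {m : ℕ} (j : ℕ) (v : Fin (m + 1) → ℂ) :
    baxterRight n q j v =
      baxterRight n q j (fun k => v k.castSucc) * baxter n q (j + m) (v (Fin.last m)) := by
  rw [baxterRight, List.ofFn_succ', List.concat_eq_append, List.prod_append, List.prod_singleton]
  rfl

theorem baxterLeft_succ {m : ℕ} (j : ℕ) (c : Fin (m + 1) → ℂ) :
    baxterLeft n q j (fun k => c k.rev) =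
      baxter n q (j + m) (c (Fin.last m)) *
        baxterLeft n q j (fun k : Fin m => c k.rev.castSucc) := by
  rw [baxterLeft, List.ofFn_succ, List.prod_cons, baxterLeft]
  simp [Fin.rev_succ]

theorem commute_baxterRight {h : HeckeAlgebra n q} {j m : ℕ}
    (hc : ∀ i < m, Commute h (sigma n q (j + i))) (v : Fin m → ℂ) :
    Commute h (baxterRight n q j v) := by
  induction m with
  | zero => simp [baxterRight]
  | succ m ih =>
    rw [baxterRight_succ]
    exact (ih (fun i hi => hc i (by omega)) _).mul_right (commute_baxter (hc m (by omega)) _)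

theorem commute_baxterLeft {h : HeckeAlgebra n q} {j m : ℕ}
    (hc : ∀ i < m, Commute h (sigma n q (j + i))) (c : Fin m → ℂ) :
    Commute h (baxterLeft n q j fun k => c k.rev) := by
  induction m with
  | zero => simp [baxterLeft]
  | succ m ih =>
    rw [baxterLeft_succ]
    exact (commute_baxter (hc m (by omega)) _).mul_right
      (ih (fun i hi => hc i (by omega)) fun k => c k.castSucc)

/-! ### The fused Yang-Baxter equations without projections -/

/-- The factor `X(x / z)` is carried through one pair of factors at a time by the Yang–Baxter
equation; the values `c` are arbitrary, so no tableau enters. -/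
theorem baxter_mul_baxterRight_mul_baxterRight (hq0 : q ≠ 0) {j m : ℕ} (hj : 1 ≤ j)
    (hn : j + m < n) (c : Fin m → ℂ) {x z : ℂ} (hz : z ≠ 0) (hxz : x ≠ z)
    (hx : ∀ k, x * c k ≠ 1) (hzc : ∀ k, z * c k ≠ 1) :
    baxter n q j (x / z) * baxterRight n q (j + 1) (fun k => x * c k) *
        baxterRight n q j (fun k => z * c k) =
      baxterRight n q (j + 1) (fun k => z * c k) * baxterRight n q j (fun k => x * c k) *
        baxter n q (j + m) (x / z) := by
  induction m with
  | zero => simp [baxterRight]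
  | succ m ih =>
    have h := ih (by omega) (fun k => c k.castSucc) (fun k => hx _) (fun k => hzc _)
    have hcom : ∀ u : ℂ, ∀ v : Fin m → ℂ,
        Commute (baxter n q (j + 1 + m) u) (baxterRight n q j v) := fun u v =>
      commute_baxterRight (fun i hi =>
        (commute_baxter (sigma_commute (Or.inl (by omega))) u).symm) v
    have hy := baxter_yang_baxter (n := n) hq0 (i := j + m) (by omega) (by omega)
      (x := x / z) (y := x * c (Fin.last m)) (z := z * c (Fin.last m))
      (by rw [div_mul_eq_mul_div, ← mul_assoc, mul_comm x z, mul_assoc, mul_div_cancel_left₀ _ hz])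
      (by rwa [Ne, div_eq_one_iff_eq hz]) (hx _) (hzc _)
    simp only [baxterRight_succ]
    rw [show j + (m + 1) = j + m + 1 by omega]
    have hs : j + 1 + m = j + m + 1 := by omega
    rw [hs] at hcom
    rw [hs]
    set R1 := baxterRight n q (j + 1) fun k : Fin m => x * c k.castSucc
    set R0 := baxterRight n q j fun k : Fin m => z * c k.castSucc with hR0
    set R1' := baxterRight n q (j + 1) fun k : Fin m => z * c k.castSucc
    set R0' := baxterRight n q j fun k : Fin m => x * c k.castSucc with hR0'
    set u := x * c (Fin.last m)
    set w := z * c (Fin.last m)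
    have c1 : Commute (baxter n q (j + m + 1) u) R0 := hcom _ _
    have c2 : Commute (baxter n q (j + m + 1) w) R0' := hcom _ _
    calc baxter n q j (x / z) * (R1 * baxter n q (j + m + 1) u) * (R0 * baxter n q (j + m) w)
        = (baxter n q j (x / z) * R1 * R0) *
            (baxter n q (j + m + 1) u * baxter n q (j + m) w) := by
          simp only [mul_assoc]
          rw [← mul_assoc _ R0, c1.eq, mul_assoc]
      _ = R1' * R0' * (baxter n q (j + m + 1) w * baxter n q (j + m) u *
            baxter n q (j + m + 1) (x / z)) := by
          rw [h, ← hy]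
          simp only [mul_assoc]
      _ = _ := by
          simp only [mul_assoc]
          rw [← mul_assoc R0', ← c2.eq]
          simp only [mul_assoc]

theorem baxter_mul_baxterLeft_mul_baxterLeft (hq0 : q ≠ 0) {j m : ℕ} (hj : 1 ≤ j)
    (hn : j + m < n) (c : Fin m → ℂ) {x z : ℂ} (hz : z ≠ 0) (hxz : x ≠ z)
    (hx : ∀ k, x * c k ≠ 1) (hzc : ∀ k, z * c k ≠ 1) :
    baxter n q (j + m) (x / z) * baxterLeft n q j (fun k => x * c k.rev) *
        baxterLeft n q (j + 1) (fun k => z * c k.rev) =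
      baxterLeft n q j (fun k => z * c k.rev) * baxterLeft n q (j + 1) (fun k => x * c k.rev) *
        baxter n q j (x / z) := by
  induction m with
  | zero => simp [baxterLeft]
  | succ m ih =>
    have h := ih (by omega) (fun k => c k.castSucc) (fun k => hx _) (fun k => hzc _)
    have hcom : ∀ u y : ℂ, Commute (baxter n q (j + m + 1) u)
        (baxterLeft n q j fun k : Fin m => y * c k.rev.castSucc) := fun u y =>
      commute_baxterLeft (fun i hi =>
        (commute_baxter (sigma_commute (Or.inl (by omega))) u).symm) fun k => y * c k.castSucc
    have hy := baxter_yang_baxter (n := n) hq0 (i := j + m) (by omega) (by omega)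
      (x := z * c (Fin.last m)) (y := x * c (Fin.last m)) (z := x / z)
      (by rw [mul_comm z, mul_assoc, mul_div_cancel₀ _ hz, mul_comm]) (hzc _) (hx _)
      (by rwa [Ne, div_eq_one_iff_eq hz])
    rw [baxterLeft_succ j fun k => x * c k, baxterLeft_succ j fun k => z * c k,
      baxterLeft_succ (j + 1) fun k => x * c k, baxterLeft_succ (j + 1) fun k => z * c k]
    rw [show j + (m + 1) = j + m + 1 by omega, show j + 1 + m = j + m + 1 by omega]
    set L0 := baxterLeft n q j fun k : Fin m => x * c k.rev.castSucc
    set L1 := baxterLeft n q (j + 1) fun k : Fin m => z * c k.rev.castSucc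
    set L0' := baxterLeft n q j fun k : Fin m => z * c k.rev.castSucc
    set L1' := baxterLeft n q (j + 1) fun k : Fin m => x * c k.rev.castSucc
    set u := x * c (Fin.last m)
    set w := z * c (Fin.last m)
    have c1 : Commute (baxter n q (j + m + 1) w) L0 := hcom _ _
    have c2 : Commute (baxter n q (j + m + 1) u) L0' := hcom _ _
    calc baxter n q (j + m + 1) (x / z) * (baxter n q (j + m) u * L0) *
          (baxter n q (j + m + 1) w * L1)
        = (baxter n q (j + m + 1) (x / z) * baxter n q (j + m) u * baxter n q (j + m + 1) w) *
            (L0 * L1) := by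
          simp only [mul_assoc]
          rw [← mul_assoc L0, ← c1.eq, mul_assoc]
      _ = baxter n q (j + m) w * baxter n q (j + m + 1) u * (L0' * L1' * baxter n q j (x / z)) := by
          rw [← hy, ← h]
          simp only [mul_assoc]
      _ = _ := by
          simp only [mul_assoc]
          rw [← mul_assoc _ L0', c2.eq]
          simp only [mul_assoc]

theorem baxterRight_mul_baxter_mul_baxterLeft (hq0 : q ≠ 0) {j m : ℕ} (hj : 1 ≤ j)
    (hn : j + m < n) (c : Fin m → ℂ) {x z : ℂ} (hc : ∀ k, c k ≠ 0) (hxz : x * z ≠ 1)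
    (hx : ∀ k, x * c k ≠ 1) (hzc : ∀ k, z / c k ≠ 1) :
    baxterRight n q j (fun k => x * c k) * baxter n q (j + m) (x * z) *
        baxterLeft n q j (fun k => z / c k.rev) =
      baxterLeft n q (j + 1) (fun k => z / c k.rev) * baxter n q j (x * z) *
        baxterRight n q (j + 1) (fun k => x * c k) := by
  induction m with
  | zero => simp [baxterLeft, baxterRight]
  | succ m ih =>
    have h := ih (by omega) (fun k => c k.castSucc) (fun k => hc _) (fun k => hx _)
      (fun k => hzc _)
    have hy := baxter_yang_baxter (n := n) hq0 (i := j + m) (by omega) (by omega)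
      (x := x * c (Fin.last m)) (y := x * z) (z := z / c (Fin.last m))
      (by rw [mul_assoc, mul_div_cancel₀ _ (hc _)]) (hx _) hxz (hzc _)
    rw [baxterLeft_succ j fun k => z / c k, baxterLeft_succ (j + 1) fun k => z / c k]
    simp only [baxterRight_succ]
    rw [show j + (m + 1) = j + m + 1 by omega, show j + 1 + m = j + m + 1 by omega]
    set R := baxterRight n q j fun k : Fin m => x * c k.castSucc
    set L := baxterLeft n q j fun k : Fin m => z / c k.rev.castSucc
    set R' := baxterRight n q (j + 1) fun k : Fin m => x * c k.castSucc
    set L' := baxterLeft n q (j + 1) fun k : Fin m => z / c k.rev.castSucc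
    set u := x * c (Fin.last m)
    set w := z / c (Fin.last m)
    have c1 : Commute (baxter n q (j + m + 1) w) R := commute_baxterRight (fun i hi =>
      (commute_baxter (sigma_commute (Or.inl (by omega))) w).symm) _
    have c2 : Commute (baxter n q (j + m + 1) u) L := commute_baxterLeft (fun i hi =>
      (commute_baxter (sigma_commute (Or.inl (by omega))) u).symm) fun k => z / c k.castSucc
    calc R * baxter n q (j + m) u * baxter n q (j + m + 1) (x * z) * (baxter n q (j + m) w * L)
        = R * (baxter n q (j + m) u * baxter n q (j + m + 1) (x * z) * baxter n q (j + m) w) *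
            L := by simp only [mul_assoc]
      _ = baxter n q (j + m + 1) w * (R * baxter n q (j + m) (x * z) * L) *
            baxter n q (j + m + 1) u := by
          rw [hy]
          simp only [mul_assoc]
          rw [c2.eq, ← mul_assoc R, ← c1.eq, mul_assoc]
      _ = _ := by
          rw [h]
          simp only [mul_assoc]

/-! ### Absorbing the second idempotent -/

theorem content_ne_zero (hq0 : q ≠ 0) {m : ℕ} (T : StandardTableau m) (k : Fin m) :
    content q T k ≠ 0 :=
  nodeContent_ne_zero hq0 _

/-- The number one sits in the corner. Thus excluding `x = c_1` makes the factor `a - b = 1 - x` of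
the factorization cancellable. -/
theorem content_zero {m : ℕ} (T : StandardTableau (m + 1)) : content q T 0 = 1 := by
  have hmem : ((0, 0) : ℕ × ℕ) ∈ T.shape.cells :=
    T.shape.isLowerSet (Prod.le_def.2 ⟨Nat.zero_le _, Nat.zero_le _⟩)
      ((T.mem_shape_iff _).2 ⟨0, rfl⟩)
  obtain ⟨k, hk⟩ := (T.mem_shape_iff _).1 hmem
  have h0 : k = 0 := Fin.le_zero_iff.1 (T.le_of_node_le k 0
    (by rw [hk]; exact Prod.le_def.2 ⟨Nat.zero_le _, Nat.zero_le _⟩))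
  rw [content, ← h0, hk]
  simp [nodeContent]

theorem exists_smul_baxterLeft (hq0 : q ≠ 0) {m : ℕ} (j : ℕ) (T : StandardTableau m) {x : ℂ}
    (hx : ∀ k, x ≠ content q T k) :
    ∃ t : ℂ, t ≠ 0 ∧
      fusedDesc (RingHom.id (HeckeAlgebra n q)) (RingHom.id ℂ) 1 x j T =
        t • baxterLeft n q j fun k => x / content q T k.rev := by
  induction m with
  | zero => exact ⟨1, one_ne_zero, by simp [fusedDesc, baxterLeft]⟩
  | succ m ih =>
    obtain ⟨t, ht, h⟩ := ih T.init fun k => hx k.castSucc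
    have hc := content_ne_zero hq0 T (Fin.last m)
    have h1 : content q T (Fin.last m) - x ≠ 0 := sub_ne_zero.2 (hx _).symm
    refine ⟨(content q T (Fin.last m) - x) * t, mul_ne_zero h1 ht, ?_⟩
    have h2 : x / content q T (Fin.last m) ≠ 1 := by
      rw [Ne, div_eq_one_iff_eq hc]; exact hx _
    have h3 := congrArg (content q T (Fin.last m) • ·) (smul_baxter (n := n) (q := q) h2 (j + m))
    simp only [smul_smul, smul_sub, mul_sub, mul_one, mul_div_cancel₀ _ hc] at h3
    rw [fusedDesc, h, baxterLeft_succ j fun k => x / content q T k]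
    simp only [RingHom.id_apply, one_mul]
    rw [← h3, smul_mul_assoc, mul_smul_comm, smul_smul]
    rfl

/-- The descending fused operator absorbs the shifted idempotent on the right. -/
theorem idempotent_mul_baxterLeft_mul_idempotent (hq0 : q ≠ 0)
    (hq : ∀ k : ℕ, 0 < k → q ^ k ≠ 1) {j m : ℕ} (hj : 1 ≤ j) (hm : j + m ≤ n)
    (T : StandardTableau m) {x : ℂ} (hx : ∀ k, x ≠ content q T k) :
    idempotent n q j T * (baxterLeft n q j fun k => x / content q T k.rev) *
        idempotent n q (j + 1) T =
      idempotent n q j T * baxterLeft n q j fun k => x / content q T k.rev := by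
  cases m with
  | zero => simp [idempotent]
  | succ m =>
    obtain ⟨t, ht, h⟩ := exists_smul_baxterLeft (n := n) hq0 j T hx
    have hf : ∀ (c : ℂ) (h : HeckeAlgebra n q), RingHom.id _ (c • h) =
      RingHom.id ℂ c • RingHom.id _ h := fun _ _ => rfl
    have h1 := idempotent_mul_fusedDesc (a := 1) (b := x) hq0 hq hf hj hm T
    -- Now the right side ends in `A_{j+1}`, so multiplying by it once more changes nothing.
    rw [intertwine_idempotent_map hq0 hj hm, h] at h1
    have h2 : (1 - x) * t ≠ 0 := by
      refine mul_ne_zero (sub_ne_zero.2 ?_) ht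
      rw [← content_zero (q := q) T]
      exact (hx 0).symm
    simp only [RingHom.id_apply, mul_smul_comm, smul_smul] at h1
    have h3 := congrArg (· * idempotent n q (j + 1) T) h1
    simp only [smul_mul_assoc, mul_assoc, idempotent_mul_self hq0 hq (show 1 ≤ j + 1 by omega)
      (show j + 1 + (m + 1) ≤ n + 1 by omega) T] at h3
    rw [← h1] at h3
    rw [mul_assoc]
    exact smul_right_injective _ h2 h3

/-! ### Cancellation over polynomials and absorption for ascending products -/

section Polynomial

open Polynomial

/-- The polynomials over a `ℂ`-algebra as an algebra over the complex polynomials. -/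
noncomputable abbrev polynomialAlgebra (R : Type*) [Ring R] [Algebra ℂ R] : Algebra ℂ[X] R[X] :=
  (mapRingHom (algebraMap ℂ R)).toAlgebra' fun p r => by
    induction p using Polynomial.induction_on' with
    | add p p' hp hp' => rw [map_add, add_mul, mul_add, hp, hp']
    | monomial k c =>
      rw [coe_mapRingHom, map_monomial, ← C_mul_X_pow_eq_monomial, mul_assoc, X_pow_mul,
        ← mul_assoc, ← mul_assoc]
      congr 1
      ext i
      simp [Algebra.commutes]

attribute [local instance] polynomialAlgebra

variable {R : Type*} [Ring R] [Algebra ℂ R]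

theorem polynomial_smul_eq (p : ℂ[X]) (r : R[X]) : p • r = p.map (algebraMap ℂ R) * r :=
  rfl

theorem C_smul_eq (c : ℂ) (h : R) : (C (c • h) : R[X]) = (C c : ℂ[X]) • (C h : R[X]) := by
  rw [polynomial_smul_eq, map_C, ← C_mul, Algebra.smul_def]

/-- The coefficients satisfy `b p_0 = 0` and `b p_{i+1} = a p_i`, so they vanish successively. At a
particular scalar `X = x` the factor could be a zero divisor. -/
theorem eq_zero_of_X_smul_sub_mul {a b b' : R} (hb : b' * b = 1) {p : R[X]}
    (h : ((X : ℂ[X]) • (C a : R[X]) - (1 : ℂ[X]) • C b) * p = 0) : p = 0 := by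
  rw [one_smul, polynomial_smul_eq, map_X, sub_mul, sub_eq_zero] at h
  ext i
  have hcancel : ∀ r : R, b * r = 0 → r = 0 := fun r hr => by
    rw [← one_mul r, ← hb, mul_assoc, hr, mul_zero]
  rw [coeff_zero]
  refine hcancel _ ?_
  have hi := congrArg (fun r => coeff r i) h
  simp only [coeff_C_mul, mul_assoc] at hi
  rw [← hi]
  clear hi
  induction i with
  | zero => simp
  | succ i ih =>
    have hi := congrArg (fun r => coeff r i) h
    simp only [coeff_C_mul, mul_assoc] at hi
    rw [hi] at ih
    rw [coeff_X_mul, coeff_C_mul, hcancel _ ih, mul_zero]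

/-- Every factor `c_i X - 1` has invertible constant term. -/
theorem eq_zero_of_fusedScalar_smul {m : ℕ} (T : StandardTableau m) {p : R[X]}
    (h : fusedScalar q (C : ℂ →+* ℂ[X]) X 1 T • p = 0) : p = 0 := by
  induction m with
  | zero => simpa [fusedScalar] using h
  | succ m ih =>
    refine ih T.init (eq_zero_of_X_smul_sub_mul (a := content q T (Fin.last m) • 1)
      (one_mul (1 : R)) ?_)
    rw [fusedScalar, mul_smul, sub_smul, mul_smul] at h
    rw [C_smul_eq, sub_mul, smul_mul_assoc, smul_mul_assoc, smul_mul_assoc, C_1, one_mul]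
    exact h

/-- Evaluation of a polynomial over a `ℂ`-algebra at a scalar. -/
noncomputable def evalScalar (R : Type*) [Ring R] [Algebra ℂ R] (x : ℂ) : R[X] →+* R :=
  eval₂RingHom' (RingHom.id R) (algebraMap ℂ R x) fun r => (Algebra.commutes x r).symm

theorem evalScalar_C (x : ℂ) (r : R) : evalScalar R x (C r) = r := by
  simp [evalScalar, eval₂RingHom']

theorem evalScalar_smul (x : ℂ) (p : ℂ[X]) (r : R[X]) :
    evalScalar R x (p • r) = p.eval x • evalScalar R x r := by
  rw [polynomial_smul_eq, map_mul, Algebra.smul_def]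
  congr 1
  simp [evalScalar, eval₂RingHom', eval₂_map, eval₂_at_apply]

theorem exists_smul_baxterRight {m : ℕ} (j : ℕ) (T : StandardTableau m) {x : ℂ}
    (hx : ∀ k, x * content q T k ≠ 1) :
    ∃ t : ℂ, t ≠ 0 ∧
      evalScalar _ x (fusedAsc (C : HeckeAlgebra n q →+* (HeckeAlgebra n q)[X])
        (C : ℂ →+* ℂ[X]) X 1 j T) = t • baxterRight n q j fun k => x * content q T k := by
  induction m with
  | zero => exact ⟨1, one_ne_zero, by simp [fusedAsc, baxterRight]⟩
  | succ m ih =>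
    obtain ⟨t, ht, h⟩ := ih T.init fun k => hx k.castSucc
    refine ⟨t * (1 - x * content q T (Fin.last m)),
      mul_ne_zero ht (sub_ne_zero.2 (hx _).symm), ?_⟩
    rw [fusedAsc, map_mul, h, map_sub, evalScalar_smul, evalScalar_smul, evalScalar_C,
      evalScalar_C, baxterRight_succ]
    simp only [eval_one, one_smul, eval_mul, eval_X, eval_C]
    rw [← smul_baxter (hx _), smul_mul_assoc, mul_smul_comm, smul_smul]
    rfl

/-- The ascending fused operator absorbs the unshifted idempotent on the right. -/
theorem idempotent_mul_baxterRight_mul_idempotent (hq0 : q ≠ 0)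
    (hq : ∀ k : ℕ, 0 < k → q ^ k ≠ 1) {j m : ℕ} (hj : 1 ≤ j) (hm : j + m ≤ n)
    (T : StandardTableau m) {x : ℂ} (hx : ∀ k, x * content q T k ≠ 1) :
    idempotent n q (j + 1) T * (baxterRight n q j fun k => x * content q T k) *
        idempotent n q j T =
      idempotent n q (j + 1) T * baxterRight n q j fun k => x * content q T k := by
  obtain ⟨t, ht, h⟩ := exists_smul_baxterRight (n := n) j T hx
  obtain ⟨b, hb⟩ := exists_mul_sigmaInvDesc_eq_one hq0 hj hm
  have hf : ∀ (c : ℂ) (h : HeckeAlgebra n q), (C : HeckeAlgebra n q →+* (HeckeAlgebra n q)[X])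
      (c • h) = (C : ℂ →+* ℂ[X]) c • (C : HeckeAlgebra n q →+* (HeckeAlgebra n q)[X]) h := by
    intro c h
    rw [polynomial_smul_eq, map_C, ← C_mul]
    congr 1
  have h1 := smul_mul_fusedAsc_eq_zero (K := ℂ[X]) (A := (HeckeAlgebra n q)[X]) (a := X) (b := 1) hq0 hq
    (f := (C : HeckeAlgebra n q →+* (HeckeAlgebra n q)[X])) (κ := C) hf hj hm T
  -- The constant term of `X D - D'` is left invertible, so both prefactors cancel before `X` is
  -- specialized to `x`.
  have h2 := eq_zero_of_X_smul_sub_mul hb (eq_zero_of_fusedScalar_smul T h1)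
  have h3 := congrArg (evalScalar _ x) h2
  rw [map_mul, map_mul, h, map_sub, map_one, map_zero, evalScalar_C, evalScalar_C, mul_smul_comm,
    smul_mul_assoc, smul_eq_zero_iff_right ht, mul_sub, mul_one, sub_eq_zero] at h3
  exact h3

end Polynomial

/-- The idempotent involves only `σ_j, …, σ_{j+m-2}`. -/
theorem commute_baxter_idempotent {i j m : ℕ} (h : i + 1 < j ∨ j + m ≤ i) (T : StandardTableau m)
    (x : ℂ) : Commute (baxter n q i x) (idempotent n q j T) :=
  commute_idempotent T fun k hk => (commute_baxter (sigma_commute (by omega)) x).symm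

end BaxterizedHecke

theorem proposition3p2
    (q : ℂ) (hq0 : q ≠ 0) (hq : ∀ k : ℕ, 0 < k → q ^ k ≠ 1)
    (n m j : ℕ) (hj : 1 ≤ j) (hn : j + m < n)
    (T : BaxterizedHecke.StandardTableau m) (x z : ℂ) :
    (z ≠ 0 → x ≠ z →
      (∀ k, x * BaxterizedHecke.content q T k ≠ 1) →
      (∀ k, z * BaxterizedHecke.content q T k ≠ 1) →
      BaxterizedHecke.baxter n q j (x / z) *
          BaxterizedHecke.fusedPlus n q T (j + 1) x * BaxterizedHecke.fusedPlus n q T j z =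
        BaxterizedHecke.fusedPlus n q T (j + 1) z * BaxterizedHecke.fusedPlus n q T j x *
          BaxterizedHecke.baxter n q (j + m) (x / z)) ∧
    (z ≠ 0 → x ≠ z →
      (∀ k, x ≠ BaxterizedHecke.content q T k) →
      (∀ k, z ≠ BaxterizedHecke.content q T k) →
      BaxterizedHecke.baxter n q (j + m) (x / z) *
          BaxterizedHecke.fusedMinus n q T j x * BaxterizedHecke.fusedMinus n q T (j + 1) z =
        BaxterizedHecke.fusedMinus n q T j z * BaxterizedHecke.fusedMinus n q T (j + 1) x *
          BaxterizedHecke.baxter n q j (x / z)) ∧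
    (x * z ≠ 1 →
      (∀ k, x * BaxterizedHecke.content q T k ≠ 1) →
      (∀ k, z ≠ BaxterizedHecke.content q T k) →
      BaxterizedHecke.fusedPlus n q T j x * BaxterizedHecke.baxter n q (j + m) (x * z) *
          BaxterizedHecke.fusedMinus n q T j z =
        BaxterizedHecke.fusedMinus n q T (j + 1) z * BaxterizedHecke.baxter n q j (x * z) *
          BaxterizedHecke.fusedPlus n q T (j + 1) x) := by
  open BaxterizedHecke in
  have hc := content_ne_zero hq0 T
  have hright : ∀ {y : ℂ}, (∀ k, y * content q T k ≠ 1) → ∀ i, 1 ≤ i → i + m ≤ n →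
      ∀ r, idempotent n q (i + 1) T * ((baxterRight n q i fun k => y * content q T k) *
        (idempotent n q i T * r)) =
          idempotent n q (i + 1) T * ((baxterRight n q i fun k => y * content q T k) * r) := by
    intro y hy i h1 h2 r
    rw [← mul_assoc, ← mul_assoc, idempotent_mul_baxterRight_mul_idempotent hq0 hq h1 h2 T hy,
      mul_assoc]
  have hleft : ∀ {y : ℂ}, (∀ k, y ≠ content q T k) → ∀ i, 1 ≤ i → i + m ≤ n →
      ∀ r, idempotent n q i T * ((baxterLeft n q i fun k => y / content q T k.rev) *
        (idempotent n q (i + 1) T * r)) =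
          idempotent n q i T * ((baxterLeft n q i fun k => y / content q T k.rev) * r) := by
    intro y hy i h1 h2 r
    rw [← mul_assoc, ← mul_assoc, idempotent_mul_baxterLeft_mul_idempotent hq0 hq h1 h2 T hy,
      mul_assoc]
  have hdiv : ∀ {y : ℂ}, (∀ k, y ≠ content q T k) → ∀ k, y / content q T k ≠ 1 := by
    intro y hy k
    rw [Ne, div_eq_one_iff_eq (hc k)]
    exact hy k
  refine ⟨fun hz hxz hx hzc => ?_, fun hz hxz hx hzc => ?_, fun hxz hx hzc => ?_⟩
  · have hcom := (commute_baxter_idempotent (n := n) (q := q) (i := j) (j := j + 1 + 1)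
      (Or.inl (by omega)) T (x / z)).eq
    have h := baxter_mul_baxterRight_mul_baxterRight hq0 hj hn (content q T) hz hxz hx hzc
    simp only [fusedPlus, mul_assoc] at h ⊢
    -- The inner idempotent is dropped on both sides, leaving `A_{j+2}` in front of the unprojected
    -- equation.
    rw [hright hzc (j + 1) (by omega) (by omega),
      hright hx (j + 1) (by omega) (by omega), ← h, ← mul_assoc, hcom, mul_assoc]
  · have hcom := (commute_baxter_idempotent (n := n) (q := q) (i := j + m) (j := j)
      (Or.inr le_rfl) T (x / z)).eq
    -- The unprojected equation is taken at the inverse contents.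
    have h := baxter_mul_baxterLeft_mul_baxterLeft hq0 hj hn (fun k => (content q T k)⁻¹) hz hxz
      (by simpa only [div_eq_mul_inv] using hdiv hx) (by simpa only [div_eq_mul_inv] using hdiv hzc)
    simp only [← div_eq_mul_inv] at h
    simp only [fusedMinus, mul_assoc] at h ⊢
    rw [hleft hzc j hj (by omega), hleft hx j hj (by omega), ← h, ← mul_assoc, hcom, mul_assoc]
  · have hcom := (commute_baxter_idempotent (n := n) (q := q) (i := j + m) (j := j)
      (Or.inr le_rfl) T (x * z)).eq
    have hcom' := (commute_baxter_idempotent (n := n) (q := q) (i := j) (j := j + 1 + 1)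
      (Or.inl (by omega)) T (x * z)).eq
    have h := baxterRight_mul_baxter_mul_baxterLeft hq0 hj hn (content q T) hc hxz hx (hdiv hzc)
    simp only [fusedMinus, fusedPlus, mul_assoc] at h ⊢
    -- Here the idempotent to be absorbed lies beyond the middle Baxterized factor and must first be
    -- moved across it, on both sides.
    rw [← mul_assoc (baxter n q (j + m) _), hcom, mul_assoc, hright hx j hj (by omega), h,
      ← mul_assoc (baxter n q j _) (idempotent n q _ T), hcom', mul_assoc,
      hleft hzc (j + 1) (by omega) (by omega)]
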